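/- **Setting.** Let $d\ge 1$, $\sigma>0$, and let $\eta=(\eta_1,\dots,\eta_d)\in\mathbb R^d$ satisfy $|\eta_1|\ge|\eta_2|\ge\dots\ge|\eta_d|>0$. One observes $y_j=\theta_j+\sigma\xi_j$, $j=1,\dots,d$, and wants to estimate $L(\theta)=\sum_{j=1}^d\eta_j\theta_j$. For $s\in\{1,\dots,d\}$ let $\Theta_s=\{\theta\in\mathbb R^d:\ \theta \text{ has at most } s \text{ nonzero coordinates}\}$. For $\alpha,\tau>0$ let $\mathcal H_{\alpha,\tau}$ be the class of probability distributions on $\mathbb R$ of random variables $W$ with $\mathbb E W=0$, $\mathbb E W^2=1$ and $\mathbb P(|W|\ge t)\le 2\exp\{-(t/\tau)^\alpha\}$ for all $t\ge 0$, and let $\mathcal H_{\alpha,\tau}^{\otimes}=\{\bigotimes_{j=1}^dP_j:\ P_j\in\mathcal H_{\alpha,\tau}\}$. Write $\mathbb E_{\theta,\mathcal P_\xi}$ for the expectation when the signal is $\theta$ and $\xi\sim\mathcal P_\xi$, and $$R^*(s)=\inf_{\hat L}\ \sup_{\theta\in\Theta_s}\ \sup_{\mathcal P_\xi\in\mathcal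 H_{\alpha,\tau}^{\otimes}}\mathbb E_{\theta,\mathcal P_\xi}\bigl(\hat L-L(\theta)\bigr)^2,$$ the infimum being over all estimators, i.e. all measurable functions $\hat L$ of $(y_1,\dots,y_d)$. Let $\beta\in\mathbb R$ be the unique solution of $$\frac{\sum_{j=1}^d|\eta_j|\exp(-\beta/|\eta_j|^\alpha)}{\sqrt{\sum_{j=1}^d\eta_j^2\exp(-\beta/|\eta_j|^\alpha)}}=\frac s2,$$ and put $\lambda_o=\max(\beta,0)^{1/\alpha}$, $\nu=\sqrt{\sum_{j=1}^d\eta_j^2\exp(-(\lambda_o/|\eta_j|)^\alpha)}$ and $\Phi_o(s;\eta)=(\lambda_os+\nu)^2$. When $s^2+s\le d+1$, let $\lambda_{\mathcal H}\ge 0$ be the unique nonnegative solution of $$\sum_{s^2\le j\le d}\exp\bigl(-|\lambda_{\mathcal H}/\eta_j|^\alpha\bigr)=s.$$ **Theorem.** For every $\alpha>0$ there exist $\tau_\alpha>0$ and $c>0$, depending only on $\alpha$, such that the following hold. 1. For all $\tau\ge\tau_\alpha$, $\sigma>0$, $d\ge1$, $s\in\{1,\dots,d\}$ and all $\eta$ as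 above, $$R^*(s)\ \ge\ c\,\sigma^2\,\Phi_o(s;\eta).$$ 2. For all $\tau\ge\tau_\alpha$ and every constant $\bar C$ there is a constant $c'>0$, depending only on $(\alpha,\tau,\bar C)$, such that for all $\sigma>0$, $d\ge1$, $s\in\{1,\dots,d\}$ and all $\eta$ as above, if $s^2+s\le d+1$ and $$\sum_{s^2\le j\le d}\frac{\lambda_{\mathcal H}^4}{\eta_j^4}\exp\bigl(-2|\lambda_{\mathcal H}/\eta_j|^\alpha\bigr)\le\bar C,$$ then $$R^*(s)\ \ge\ c'\,\sigma^2\,s^2\,\lambda_{\mathcal H}^2.$$ -/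

import Mathlib

open MeasureTheory

noncomputable section

namespace SparseLinear

variable {d : ℕ}

/-! ### The noise class and the observation model -/

/-- The class of noise laws on `ℝ` (not necessarily symmetric) with mean zero, unit variance and
`P(|W| ≥ t) ≤ 2 exp (-(t / τ) ^ α)` for all `t ≥ 0`.  The requirement `∫ x ^ 2 = 1` forces `x ^ 2`
(hence `x`) to be integrable, so both moments are genuine. -/
def noiseClass (α τ : ℝ) : Set (Measure ℝ) :=
  {P | IsProbabilityMeasure P ∧ ∫ x, x ∂P = 0 ∧ ∫ x, x ^ 2 ∂P = 1 ∧
    ∀ t : ℝ, 0 ≤ t → P.real {x | t ≤ |x|} ≤ 2 * Real.exp (-(t / τ) ^ α)}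

/-- Product laws on `ℝ^d` whose marginals, possibly different, all lie in `noiseClass α τ`. -/
def noiseProductClass (d : ℕ) (α τ : ℝ) : Set (Measure (Fin d → ℝ)) :=
  {Q | ∃ P : Fin d → Measure ℝ, (∀ j, P j ∈ noiseClass α τ) ∧ Q = Measure.pi P}

/-- The vectors with at most `s` nonzero coordinates. -/
def sparseVectors (d s : ℕ) : Set (Fin d → ℝ) := {θ | hammingNorm θ ≤ s}

/-- The linear functional with loading vector `η`. -/
def linearFunctional (η θ : Fin d → ℝ) : ℝ := ∑ j, η j * θ j

/-- The law of the observation `y_j = θ_j + σ ξ_j`, where `ξ` has law `Q`. -/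
def observationLaw (σ : ℝ) (θ : Fin d → ℝ) (Q : Measure (Fin d → ℝ)) : Measure (Fin d → ℝ) :=
  Q.map fun ξ j => θ j + σ * ξ j

/-- Mean squared error of the estimator `T` of the linear functional, in `[0, ∞]`. -/
def meanSquaredError (σ : ℝ) (η θ : Fin d → ℝ) (Q : Measure (Fin d → ℝ))
    (T : (Fin d → ℝ) → ℝ) : ENNReal :=
  ∫⁻ y, ENNReal.ofReal ((T y - linearFunctional η θ) ^ 2) ∂(observationLaw σ θ Q)

/-- The minimax risk: infimum over all measurable functions of the data of the worst mean squared
error over `s`-sparse vectors and over product noise in the class. -/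
def minimaxRisk (α τ σ : ℝ) (s : ℕ) (η : Fin d → ℝ) : ENNReal :=
  ⨅ (T : (Fin d → ℝ) → ℝ) (_ : Measurable T),
    ⨆ (θ ∈ sparseVectors d s) (Q ∈ noiseProductClass d α τ), meanSquaredError σ η θ Q T

/-! ### The symmetric rate -/

/-- The ratio `∑ |η_j| exp (-β/|η_j|^α) / √(∑ η_j² exp (-β/|η_j|^α))`. -/
def oracleRatio (α : ℝ) (η : Fin d → ℝ) (β : ℝ) : ℝ :=
  (∑ j, |η j| * Real.exp (-β / |η j| ^ α)) /
    √(∑ j, η j ^ 2 * Real.exp (-β / |η j| ^ α))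

/-- The solution `β` of `oracleRatio α η β = s / 2`; it exists and is unique when `α > 0`,
`d ≥ 1`, `s > 0` and no loading vanishes, see `existsUnique_oracleBeta`. -/
def oracleBeta (α : ℝ) (s : ℕ) (η : Fin d → ℝ) : ℝ :=
  Classical.epsilon fun β : ℝ => oracleRatio α η β = s / 2

/-- `λ_o = (β₊)^{1/α}`. -/
def oracleLambda (α : ℝ) (s : ℕ) (η : Fin d → ℝ) : ℝ :=
  (max (oracleBeta α s η) 0) ^ (1 / α)

/-- `ν = √(∑ η_j² exp (-(λ_o/|η_j|)^α))`. -/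
def oracleNu (α : ℝ) (s : ℕ) (η : Fin d → ℝ) : ℝ :=
  √(∑ j, η j ^ 2 * Real.exp (-(oracleLambda α s η / |η j|) ^ α))

/-- `Φ_o(s; η) = (λ_o s + ν)²`. -/
def oracleRate (α : ℝ) (s : ℕ) (η : Fin d → ℝ) : ℝ :=
  (oracleLambda α s η * s + oracleNu α s η) ^ 2

/-! ### The asymmetric threshold -/

/-- The positions `j ∈ {1, …, d}` with `j ≥ s²`; the element `j : Fin d` is the position `j + 1`. -/
def tailIndices (d s : ℕ) : Finset (Fin d) :=
  Finset.univ.filter fun j : Fin d => s ^ 2 ≤ (j : ℕ) + 1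

/-- The solution `λ ≥ 0` of `∑_{j ≥ s²} exp (-|λ/η_j|^α) = s`; it exists and is unique when
`α > 0`, `s ≥ 1`, `s² + s ≤ d + 1` and no loading vanishes, see `existsUnique_asymLambda`. -/
def asymLambda (α : ℝ) (s : ℕ) (η : Fin d → ℝ) : ℝ :=
  Classical.epsilon fun l : ℝ =>
    0 ≤ l ∧ ∑ j ∈ tailIndices d s, Real.exp (-|l / η j| ^ α) = s

/-- The sum `∑_{j ≥ s²} λ_H⁴/η_j⁴ exp (-2|λ_H/η_j|^α)`. -/
def asymMoment (α : ℝ) (s : ℕ) (η : Fin d → ℝ) : ℝ :=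
  ∑ j ∈ tailIndices d s, asymLambda α s η ^ 4 / η j ^ 4 *
    Real.exp (-2 * |asymLambda α s η / η j| ^ α)

/-! ### Well-posedness of the two defining equations -/

theorem oracleRatio_strictAnti {α : ℝ} (hα : 0 < α) {η : Fin d → ℝ} (hd : 0 < d)
    (hη : ∀ j, η j ≠ 0) : StrictAnti (oracleRatio α η) := by
  have : Nonempty (Fin d) := ⟨⟨0, hd⟩⟩
  intro b b' hb
  set a : Fin d → ℝ := fun j => |η j| with ha
  have ha0 : ∀ j, 0 < a j := fun j => abs_pos.mpr (hη j)
  set e : Fin d → ℝ := fun j => Real.exp (-b / a j ^ α) with he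
  set r : Fin d → ℝ := fun j => Real.exp (-(b' - b) / a j ^ α) with hr
  have he0 : ∀ j, 0 < e j := fun j => Real.exp_pos _
  have hr0 : ∀ j, 0 < r j := fun j => Real.exp_pos _
  have hp : ∀ j, 0 < a j ^ α := fun j => Real.rpow_pos_of_pos (ha0 j) α
  have hr1 : ∀ j, r j < 1 := fun j => by
    rw [hr]; apply Real.exp_lt_one_iff.mpr
    exact div_neg_of_neg_of_pos (by linarith) (hp j)
  have her : ∀ j, Real.exp (-b' / a j ^ α) = e j * r j := fun j => by
    rw [he, hr]; simp only; rw [← Real.exp_add]; congr 1; ring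
  have hmono : ∀ i j, a i ≤ a j → r i ≤ r j := fun i j hij => by
    have h1 : a i ^ α ≤ a j ^ α := Real.rpow_le_rpow (ha0 i).le hij hα.le
    rw [hr]; simp only
    apply Real.exp_le_exp.mpr
    rw [neg_div, neg_div]
    exact neg_le_neg (div_le_div_of_nonneg_left (by linarith) (hp i) h1)
  have hprod : ∀ i j, 0 ≤ (r i - r j) * (a i - a j) := fun i j => by
    rcases le_total (a i) (a j) with h | h
    · exact mul_nonneg_of_nonpos_of_nonpos (by linarith [hmono i j h]) (by linarith)
    · exact mul_nonneg (by linarith [hmono j i h]) (by linarith)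
  set A := ∑ j, a j * e j with hA
  set B := ∑ j, a j ^ 2 * e j with hB
  set A' := ∑ j, a j * (e j * r j) with hA'
  set B' := ∑ j, a j ^ 2 * (e j * r j) with hB'
  have hA0 : 0 < A := Finset.sum_pos (fun j _ => mul_pos (ha0 j) (he0 j)) Finset.univ_nonempty
  have hB0 : 0 < B :=
    Finset.sum_pos (fun j _ => mul_pos (pow_pos (ha0 j) 2) (he0 j)) Finset.univ_nonempty
  have hA0' : 0 < A' := Finset.sum_pos
    (fun j _ => mul_pos (ha0 j) (mul_pos (he0 j) (hr0 j))) Finset.univ_nonempty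
  have hB0' : 0 < B' := Finset.sum_pos
    (fun j _ => mul_pos (pow_pos (ha0 j) 2) (mul_pos (he0 j) (hr0 j))) Finset.univ_nonempty
  have hAA : A' < A := Finset.sum_lt_sum_of_nonempty Finset.univ_nonempty fun j _ =>
    mul_lt_mul_of_pos_left (by nlinarith [he0 j, hr1 j]) (ha0 j)
  have hcheb : A' * B ≤ A * B' := by
    have h : 0 ≤ ∑ i, ∑ j, (a i * e i) * (a j * e j) * ((r i - r j) * (a i - a j)) :=
      Finset.sum_nonneg fun i _ => Finset.sum_nonneg fun j _ =>
        mul_nonneg (mul_nonneg (mul_nonneg (ha0 i).le (he0 i).le)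
          (mul_nonneg (ha0 j).le (he0 j).le)) (hprod i j)
    have hexp : ∑ i, ∑ j, (a i * e i) * (a j * e j) * ((r i - r j) * (a i - a j))
        = B' * A - A' * B - (B * A' - A * B') := by
      rw [hA, hB, hA', hB']
      simp only [Finset.sum_mul_sum, ← Finset.sum_sub_distrib]
      refine Finset.sum_congr rfl fun i _ => Finset.sum_congr rfl fun j _ => ?_
      ring
    rw [hexp] at h
    linarith
  have hfin : A' ^ 2 * B < A ^ 2 * B' := by
    calc A' ^ 2 * B = A' * (A' * B) := by ring
      _ ≤ A' * (A * B') := mul_le_mul_of_nonneg_left hcheb hA0'.le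
      _ < A * (A * B') := mul_lt_mul_of_pos_right hAA (mul_pos hA0 hB0')
      _ = A ^ 2 * B' := by ring
  have e1 : oracleRatio α η b = A / √B := by
    simp only [oracleRatio, hA, hB, he, ha, sq_abs]
  have e2 : oracleRatio α η b' = A' / √B' := by
    simp only [oracleRatio, hA', hB', ← her]
    simp only [ha, sq_abs]
  rw [e1, e2, div_lt_div_iff₀ (Real.sqrt_pos.mpr hB0') (Real.sqrt_pos.mpr hB0)]
  refine lt_of_pow_lt_pow_left₀ 2 (by positivity) ?_
  rw [mul_pow, mul_pow, Real.sq_sqrt hB0.le, Real.sq_sqrt hB0'.le]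
  exact hfin

theorem existsUnique_oracleBeta {α : ℝ} (hα : 0 < α) {η : Fin d → ℝ} (hd : 0 < d)
    (hη : ∀ j, η j ≠ 0) {s : ℕ} (hs : 0 < s) :
    ∃! β : ℝ, oracleRatio α η β = s / 2 := by
  have : Nonempty (Fin d) := ⟨⟨0, hd⟩⟩
  have ha0 : ∀ j, 0 < |η j| := fun j => abs_pos.mpr (hη j)
  have hp : ∀ j, 0 < |η j| ^ α := fun j => Real.rpow_pos_of_pos (ha0 j) α
  have hB0 : ∀ β : ℝ, 0 < ∑ j, η j ^ 2 * Real.exp (-β / |η j| ^ α) := fun β =>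
    Finset.sum_pos (fun j _ => mul_pos (by have := hη j; positivity) (Real.exp_pos _))
      Finset.univ_nonempty
  have hA0 : ∀ β : ℝ, 0 < ∑ j, |η j| * Real.exp (-β / |η j| ^ α) := fun β =>
    Finset.sum_pos (fun j _ => mul_pos (ha0 j) (Real.exp_pos _)) Finset.univ_nonempty
  have hcont : Continuous (oracleRatio α η) := by
    unfold oracleRatio
    refine Continuous.div (by fun_prop) (by fun_prop) fun β => ?_
    exact (Real.sqrt_pos.mpr (hB0 β)).ne'
  have hs2 : (0 : ℝ) < s / 2 := by positivity
  -- upper end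
  obtain ⟨b1, hb1⟩ : ∃ b1, oracleRatio α η b1 ≤ s / 2 := by
    have ht : Filter.Tendsto (fun β : ℝ => ∑ j, Real.exp (-β / |η j| ^ α)) Filter.atTop
        (nhds (∑ _j : Fin d, 0)) := by
      refine tendsto_finsetSum _ fun j _ => Real.tendsto_exp_atBot.comp ?_
      exact Filter.Tendsto.atBot_div_const (hp j) Filter.tendsto_neg_atTop_atBot
    rw [Finset.sum_const_zero] at ht
    obtain ⟨b, hb⟩ := (ht.eventually (gt_mem_nhds (show (0 : ℝ) < (s / 2) ^ 2 by positivity))).exists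
    refine ⟨b, ?_⟩
    unfold oracleRatio
    rw [div_le_iff₀ (Real.sqrt_pos.mpr (hB0 b))]
    refine (pow_le_pow_iff_left₀ (by positivity) (by positivity) two_ne_zero).mp ?_
    rw [mul_pow, Real.sq_sqrt (hB0 b).le]
    have hcs := Finset.sum_sq_le_sum_mul_sum_of_sq_eq_mul Finset.univ
      (r := fun j => |η j| * Real.exp (-b / |η j| ^ α))
      (f := fun j => Real.exp (-b / |η j| ^ α))
      (g := fun j => η j ^ 2 * Real.exp (-b / |η j| ^ α))
      (fun j _ => (Real.exp_pos _).le) (fun j _ => by positivity)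
      (fun j _ => by rw [mul_pow, sq_abs]; ring)
    exact hcs.trans (mul_le_mul_of_nonneg_right hb.le (hB0 b).le)
  -- lower end
  obtain ⟨b2, hb2⟩ : ∃ b2, s / 2 ≤ oracleRatio α η b2 := by
    set M := ∑ j, |η j| with hM
    have hM0 : 0 < M := Finset.sum_pos (fun j _ => ha0 j) Finset.univ_nonempty
    have hle : ∀ j, |η j| ≤ M := fun j =>
      Finset.single_le_sum (f := fun j => |η j|) (fun i _ => (ha0 i).le) (Finset.mem_univ j)
    let j0 : Fin d := ⟨0, hd⟩
    have ht : Filter.Tendsto (fun β : ℝ => |η j0| * Real.exp (-β / |η j0| ^ α)) Filter.atBot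
        Filter.atTop := by
      refine Filter.Tendsto.const_mul_atTop (ha0 j0) (Real.tendsto_exp_atTop.comp ?_)
      exact Filter.Tendsto.atTop_div_const (hp j0) Filter.tendsto_neg_atBot_atTop
    obtain ⟨b, hb⟩ := (ht.eventually_ge_atTop (M * (s / 2) ^ 2)).exists
    refine ⟨b, ?_⟩
    set A := ∑ j, |η j| * Real.exp (-b / |η j| ^ α) with hA
    have hAb : M * (s / 2) ^ 2 ≤ A := hb.trans
      (Finset.single_le_sum (f := fun j => |η j| * Real.exp (-b / |η j| ^ α))
        (fun i _ => by positivity) (Finset.mem_univ j0))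
    have hBA : ∑ j, η j ^ 2 * Real.exp (-b / |η j| ^ α) ≤ M * A := by
      rw [hA, Finset.mul_sum]
      refine Finset.sum_le_sum fun j _ => ?_
      rw [← sq_abs, sq, mul_assoc]
      exact mul_le_mul_of_nonneg_right (hle j) (by positivity)
    unfold oracleRatio
    rw [le_div_iff₀ (Real.sqrt_pos.mpr (hB0 b))]
    refine (pow_le_pow_iff_left₀ (by positivity) (hA0 b).le two_ne_zero).mp ?_
    rw [mul_pow, Real.sq_sqrt (hB0 b).le]
    calc ((s : ℝ) / 2) ^ 2 * ∑ j, η j ^ 2 * Real.exp (-b / |η j| ^ α)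
        ≤ (s / 2) ^ 2 * (M * A) := mul_le_mul_of_nonneg_left hBA (by positivity)
      _ = (M * (s / 2) ^ 2) * A := by ring
      _ ≤ A * A := mul_le_mul_of_nonneg_right hAb (hA0 b).le
      _ = A ^ 2 := by ring
  obtain ⟨β, hβ⟩ := mem_range_of_exists_le_of_exists_ge hcont ⟨b1, hb1⟩ ⟨b2, hb2⟩
  exact ⟨β, hβ, fun β' hβ' =>
    (oracleRatio_strictAnti hα hd hη).injective (hβ'.trans hβ.symm)⟩

theorem existsUnique_asymLambda {α : ℝ} (hα : 0 < α) {η : Fin d → ℝ}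
    (hη : ∀ j, η j ≠ 0) {s : ℕ} (hs : 0 < s) (hsd : s ^ 2 + s ≤ d + 1) :
    ∃! l : ℝ, 0 ≤ l ∧ ∑ j ∈ tailIndices d s, Real.exp (-|l / η j| ^ α) = s := by
  have hs1 : 1 ≤ s ^ 2 := Nat.one_le_pow _ _ hs
  have hcard : (tailIndices d s).card + s ^ 2 = d + 1 := by
    have h1 : (tailIndices d s).card = (Finset.Ico (s ^ 2 - 1) d).card := by
      refine Finset.card_bij (fun j _ => (j : ℕ)) ?_ ?_ ?_
      · intro j hj
        simp only [tailIndices, Finset.mem_filter, Finset.mem_univ, true_and] at hj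
        simp only [Finset.mem_Ico]
        omega
      · intro i _ j _ h
        exact Fin.ext h
      · intro n hn
        simp only [Finset.mem_Ico] at hn
        refine ⟨⟨n, hn.2⟩, ?_, rfl⟩
        simp only [tailIndices, Finset.mem_filter, Finset.mem_univ, true_and]
        omega
    rw [h1, Nat.card_Ico]
    omega
  have hne : (tailIndices d s).Nonempty := by
    rw [← Finset.card_pos]; omega
  set g : ℝ → ℝ := fun l => ∑ j ∈ tailIndices d s, Real.exp (-|l / η j| ^ α) with hg
  have hcont : Continuous g := by
    refine continuous_finsetSum _ fun j _ => ?_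
    refine Real.continuous_exp.comp (Continuous.neg ?_)
    exact Continuous.rpow_const (by fun_prop) fun _ => Or.inr hα.le
  have hanti : StrictAntiOn g (Set.Ici 0) := by
    intro x hx y _ hxy
    have hx0 : (0 : ℝ) ≤ x := hx
    refine Finset.sum_lt_sum_of_nonempty hne fun j _ => ?_
    apply Real.exp_lt_exp.mpr
    apply neg_lt_neg
    refine Real.rpow_lt_rpow (abs_nonneg _) ?_ hα
    rw [abs_div, abs_div, abs_of_nonneg hx0, abs_of_nonneg (hx0.trans hxy.le)]
    exact div_lt_div_of_pos_right hxy (abs_pos.mpr (hη j))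
  have hg0 : (s : ℝ) ≤ g 0 := by
    have : g 0 = (tailIndices d s).card := by
      simp [hg, Real.zero_rpow hα.ne']
    rw [this]
    exact_mod_cast (by omega : s ≤ (tailIndices d s).card)
  have ht : Filter.Tendsto g Filter.atTop (nhds (∑ _j ∈ tailIndices d s, (0 : ℝ))) := by
    refine tendsto_finsetSum _ fun j _ => Real.tendsto_exp_atBot.comp ?_
    refine Filter.tendsto_neg_atTop_atBot.comp ((tendsto_rpow_atTop hα).comp ?_)
    have h : (fun l : ℝ => |l / η j|) = fun l => |l| / |η j| := by
      funext l; rw [abs_div]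
    rw [h]
    exact Filter.Tendsto.atTop_div_const (abs_pos.mpr (hη j)) Filter.tendsto_abs_atTop_atTop
  rw [Finset.sum_const_zero] at ht
  obtain ⟨b, hb, hb0⟩ := ((ht.eventually (gt_mem_nhds
    (show (0 : ℝ) < s by exact_mod_cast hs))).and (Filter.eventually_ge_atTop 0)).exists
  obtain ⟨l, hl, hgl⟩ := intermediate_value_Icc' hb0 hcont.continuousOn ⟨hb.le, hg0⟩
  exact ⟨l, ⟨hl.1, hgl⟩, fun l' h' => hanti.injOn h'.1 hl.1 (h'.2.trans hgl.symm)⟩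

end SparseLinear

end

noncomputable section

/-! The lower bound compares one law with a mixture. Under the null, θ = 0 and the noise law is
chosen adversarially; under the alternative, the noise is the symmetric three-point law on {-2, 0,
2}, and independent spikes σ h_j of probability q_j are planted in θ. Since noise laws may differ
between coordinates and need not be symmetric, the null noise can itself carry the spike: it is the
law of bulk plus spike, with the no-spike atoms slightly reweighted to restore mean 0 and variance
1. Three bulk atoms leave just enough freedom to correct both moments while keeping all weights
nonnegative. The spike atoms then have the same weight in both experiments, so they cost nothing in
chi-square; only the moment corrections do, and their total cost is of order ∑ q_j² (h_j² + h_j⁴).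
The tail condition reduces to q_j ≤ exp(-|h_j|^α) for spikes higher than 1.

While that cost stays bounded, no estimator separates the two experiments. But L is 0 under the null
and has mean σ ∑ q_j η_j h_j under the prior, and half of this mean survives restriction to s-sparse
vectors when ∑ q_j ≤ s/2. This gives `le_minimaxRisk_of_isSpike`, and the rest is the choice of
(q_j, h_j).

The rate ν comes from spikes of height 1/4 with probabilities proportional to |η_j|
exp(-(λ_o/|η_j|)^α). The rates λ_o s and λ_H s come from heights proportional to λ/η_j, so that
every spike contributes equally (`le_minimaxRisk_of_isHeightFactor`). For λ_H the spikes sit on the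
coordinates from s² on or on the first s², according to whether λ_H/|η_j| is at least or at most 1
at position s². -/

namespace SparseLinear

/-! ### Laws with finitely many atoms -/

section FiniteLaw

variable {Ω : Type*} [Fintype Ω] [MeasurableSpace Ω] [DiscreteMeasurableSpace Ω]

/-- The measure on a finite type with the given weights. -/
def finiteLaw (w : Ω → ℝ) : Measure Ω := ∑ x, ENNReal.ofReal (w x) • Measure.dirac x

theorem finiteLaw_apply (w : Ω → ℝ) (S : Set Ω) [DecidablePred (· ∈ S)] :
    finiteLaw w S = ∑ x, if x ∈ S then ENNReal.ofReal (w x) else 0 := by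
  simp only [finiteLaw, Measure.finsetSum_apply, Measure.smul_apply, smul_eq_mul]
  refine Finset.sum_congr rfl fun x _ => ?_
  rw [Measure.dirac_apply' _ (MeasurableSet.of_discrete)]
  by_cases h : x ∈ S <;> simp [h]

theorem finiteLaw_singleton (w : Ω → ℝ) (x : Ω) :
    finiteLaw w {x} = ENNReal.ofReal (w x) := by
  classical
  simp [finiteLaw_apply]

theorem finiteLaw_univ {w : Ω → ℝ} (hw : ∀ x, 0 ≤ w x) (hsum : ∑ x, w x = 1) :
    finiteLaw w Set.univ = 1 := by
  classical
  simp only [finiteLaw_apply, Set.mem_univ, if_true]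
  rw [← ENNReal.ofReal_sum_of_nonneg fun x _ => hw x, hsum, ENNReal.ofReal_one]

instance isFiniteMeasure_finiteLaw (w : Ω → ℝ) : IsFiniteMeasure (finiteLaw w) := by
  classical
  refine ⟨?_⟩
  simp only [finiteLaw_apply, Set.mem_univ, if_true]
  exact ENNReal.sum_lt_top.mpr fun x _ => ENNReal.ofReal_lt_top

theorem integral_map_finiteLaw {w : Ω → ℝ} (hw : ∀ x, 0 ≤ w x) (v : Ω → ℝ) {f : ℝ → ℝ}
    (hf : Measurable f) : ∫ y, f y ∂(finiteLaw w).map v = ∑ x, w x * f (v x) := by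
  rw [integral_map (Measurable.of_discrete).aemeasurable hf.aestronglyMeasurable,
    integral_fintype Integrable.of_finite]
  refine Finset.sum_congr rfl fun x _ => ?_
  rw [Measure.real, finiteLaw_singleton, ENNReal.toReal_ofReal (hw x), smul_eq_mul]

/-- The map `v` need not be injective, so the moment and tail conditions are checked on the latent
space even when atoms of the image coincide. -/
theorem map_finiteLaw_mem_noiseClass {α τ : ℝ} {w v : Ω → ℝ} (hw : ∀ x, 0 ≤ w x)
    (hsum : ∑ x, w x = 1) (hmean : ∑ x, w x * v x = 0) (hvar : ∑ x, w x * v x ^ 2 = 1)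
    (htail : ∀ t : ℝ, 0 ≤ t → ∑ x, (if t ≤ |v x| then w x else 0) ≤
      2 * Real.exp (-(t / τ) ^ α)) :
    (finiteLaw w).map v ∈ noiseClass α τ := by
  classical
  have hv : Measurable v := Measurable.of_discrete
  refine ⟨⟨?_⟩, ?_, ?_, fun t ht => ?_⟩
  · rw [Measure.map_apply hv MeasurableSet.univ, Set.preimage_univ, finiteLaw_univ hw hsum]
  · rw [integral_map_finiteLaw hw v (f := fun x => x) measurable_id, hmean]
  · rw [integral_map_finiteLaw hw v (f := fun x => x ^ 2) (by fun_prop), hvar]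
  · refine le_trans (le_of_eq ?_) (htail t ht)
    have hS : MeasurableSet {x : ℝ | t ≤ |x|} := measurableSet_le measurable_const (by fun_prop)
    rw [Measure.real, Measure.map_apply hv hS, finiteLaw_apply]
    simp only [Set.mem_preimage, Set.mem_ofPred_eq]
    rw [ENNReal.toReal_sum fun x _ => by split_ifs <;> simp]
    refine Finset.sum_congr rfl fun x _ => ?_
    split_ifs
    · exact ENNReal.toReal_ofReal (hw x)
    · rfl

theorem lintegral_pi_map_finiteLaw {d : ℕ} {w v : Fin d → Ω → ℝ} (hw : ∀ j x, 0 ≤ w j x)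
    {f : (Fin d → ℝ) → ENNReal} (hf : Measurable f) :
    ∫⁻ y, f y ∂Measure.pi (fun j => (finiteLaw (w j)).map (v j)) =
      ∑ x : Fin d → Ω, ENNReal.ofReal (∏ j, w j (x j)) * f fun j => v j (x j) := by
  rw [← Measure.pi_map_pi fun j => (Measurable.of_discrete).aemeasurable,
    lintegral_map hf Measurable.of_discrete, lintegral_fintype]
  refine Finset.sum_congr rfl fun x _ => ?_
  rw [Measure.pi_singleton, mul_comm, ENNReal.ofReal_prod_of_nonneg fun j _ => hw j _]
  simp only [finiteLaw_singleton]

theorem meanSquaredError_finiteLaw {d : ℕ} {w v : Fin d → Ω → ℝ} (hw : ∀ j x, 0 ≤ w j x)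
    (σ : ℝ) (η θ : Fin d → ℝ) {T : (Fin d → ℝ) → ℝ} (hT : Measurable T) :
    meanSquaredError σ η θ (Measure.pi fun j => (finiteLaw (w j)).map (v j)) T =
      ENNReal.ofReal (∑ x : Fin d → Ω, (∏ j, w j (x j)) *
        (T (fun j => θ j + σ * v j (x j)) - linearFunctional η θ) ^ 2) := by
  have hshift : Measurable fun (ξ : Fin d → ℝ) j => θ j + σ * ξ j := by fun_prop
  rw [meanSquaredError, observationLaw, lintegral_map (by fun_prop) hshift,
    lintegral_pi_map_finiteLaw hw (by fun_prop), ENNReal.ofReal_sum_of_nonneg]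
  · refine Finset.sum_congr rfl fun x _ => ?_
    rw [ENNReal.ofReal_mul (Finset.prod_nonneg fun j _ => hw j _)]
  · exact fun x _ => mul_nonneg (Finset.prod_nonneg fun j _ => hw j _) (sq_nonneg _)

end FiniteLaw

/-! ### Sums of products over a finite product -/

theorem sum_prod_pi {d : ℕ} {Ω : Type*} [Fintype Ω] (f : Fin d → Ω → ℝ) :
    ∑ x : Fin d → Ω, ∏ j, f j (x j) = ∏ j, ∑ z, f j z := by
  classical
  rw [Finset.prod_univ_sum, Fintype.piFinset_univ]

/-- Under a product law, the expectation of a function of one coordinate. -/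
theorem sum_prod_pi_mul_apply {d : ℕ} {Ω : Type*} [Fintype Ω] {f : Fin d → Ω → ℝ}
    (hf : ∀ j, ∑ z, f j z = 1) (i : Fin d) (g : Ω → ℝ) :
    ∑ x : Fin d → Ω, (∏ j, f j (x j)) * g (x i) = ∑ z, f i z * g z := by
  classical
  have h := sum_prod_pi fun j z => f j z * if j = i then g z else 1
  simp only [Finset.prod_mul_distrib, Finset.prod_ite_eq', Finset.mem_univ, if_true] at h
  rw [h, Finset.prod_eq_single i]
  · simp
  · intro j _ hj; simp [hj, hf]
  · simp

/-- Under a product law, the expectation of a product of functions of two coordinates. -/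
theorem sum_prod_pi_mul_apply_mul_apply {d : ℕ} {Ω : Type*} [Fintype Ω] {f : Fin d → Ω → ℝ}
    (hf : ∀ j, ∑ z, f j z = 1) {i k : Fin d} (hik : i ≠ k) (g g' : Ω → ℝ) :
    ∑ x : Fin d → Ω, (∏ j, f j (x j)) * (g (x i) * g' (x k)) =
      (∑ z, f i z * g z) * ∑ z, f k z * g' z := by
  classical
  have h := sum_prod_pi fun j z => f j z * ((if j = i then g z else 1) *
    if j = k then g' z else 1)
  simp only [Finset.prod_mul_distrib, Finset.prod_ite_eq', Finset.mem_univ, if_true] at h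
  rw [h, Finset.prod_eq_mul i k hik]
  · simp [hik, hik.symm]
  · intro j _ hj; simp [hj.1, hj.2, hf]
  · simp
  · simp

/-! ### Comparison of a sparse prior with a single null law -/

/-- A change-of-measure bound: if an estimator `T` has squared risk at most `r` at zero under `w₀`
and at most `r` at `L` under the restriction of `w₁` to `S`, then the restricted mean of `L` is
controlled by the chi-square affinity of `w₁` and `w₀`. -/
theorem sum_mul_le_of_risk_le {ι : Type*} [Fintype ι] (S : Finset ι) {w₀ w₁ g T L : ι → ℝ}
    {r K : ℝ} (h₀ : ∀ x, 0 ≤ w₀ x) (h₁ : ∀ x, 0 ≤ w₁ x) (hg : ∀ x, 0 ≤ g x)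
    (hw : ∀ x, w₁ x ^ 2 ≤ w₀ x * g x) (hsum : ∑ x, w₁ x ≤ 1) (hK : ∑ x, g x ≤ K)
    (hr₀ : ∑ x, w₀ x * T x ^ 2 ≤ r) (hr₁ : ∑ x ∈ S, w₁ x * (T x - L x) ^ 2 ≤ r) :
    ∑ x ∈ S, w₁ x * L x ≤ √r + √(r * K) := by
  have hr : 0 ≤ r :=
    le_trans (Finset.sum_nonneg fun x _ => mul_nonneg (h₀ x) (sq_nonneg _)) hr₀
  -- Cauchy–Schwarz bounds the first part by the risk under `w₁`; in the second, `hw` transfers `T`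
  -- to `w₀`, where its second moment is at most `r`.
  have e : ∑ x ∈ S, w₁ x * L x =
      ∑ x ∈ S, w₁ x * (L x - T x) + ∑ x ∈ S, w₁ x * T x := by
    rw [← Finset.sum_add_distrib]
    exact Finset.sum_congr rfl fun x _ => by ring
  rw [e]
  refine add_le_add (Real.le_sqrt_of_sq_le ?_) (Real.le_sqrt_of_sq_le ?_)
  · calc (∑ x ∈ S, w₁ x * (L x - T x)) ^ 2
        ≤ (∑ x ∈ S, w₁ x * (T x - L x) ^ 2) * ∑ x ∈ S, w₁ x :=
          Finset.sum_sq_le_sum_mul_sum_of_sq_le_mul S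
            (fun x _ => mul_nonneg (h₁ x) (sq_nonneg _)) (fun x _ => h₁ x)
            fun x _ => le_of_eq (by ring)
      _ ≤ r * 1 := by
          refine mul_le_mul hr₁ (le_trans ?_ hsum) (Finset.sum_nonneg fun x _ => h₁ x) hr
          exact Finset.sum_le_univ_sum_of_nonneg h₁
      _ = r := mul_one r
  · calc (∑ x ∈ S, w₁ x * T x) ^ 2
        ≤ (∑ x ∈ S, w₀ x * T x ^ 2) * ∑ x ∈ S, g x :=
          Finset.sum_sq_le_sum_mul_sum_of_sq_le_mul S
            (fun x _ => mul_nonneg (h₀ x) (sq_nonneg _)) (fun x _ => hg x) fun x _ => by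
              nlinarith [mul_le_mul_of_nonneg_right (hw x) (sq_nonneg (T x))]
      _ ≤ r * K := by
          refine mul_le_mul (le_trans ?_ hr₀) (le_trans ?_ hK)
            (Finset.sum_nonneg fun x _ => hg x) hr
          · exact Finset.sum_le_univ_sum_of_nonneg fun x => mul_nonneg (h₀ x) (sq_nonneg _)
          · exact Finset.sum_le_univ_sum_of_nonneg hg

/-- The Bernoulli weights on `Bool`. -/
def bernoulliWeight (q : ℝ) (b : Bool) : ℝ := if b then q else 1 - q

theorem bernoulliWeight_nonneg {q : ℝ} (h0 : 0 ≤ q) (h1 : q ≤ 1) (b : Bool) :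
    0 ≤ bernoulliWeight q b := by
  cases b <;> simp [bernoulliWeight, h0, h1]

theorem sum_bernoulliWeight (q : ℝ) : ∑ b, bernoulliWeight q b = 1 := by
  simp [bernoulliWeight]

/-- The number of successes. -/
def successCount {d : ℕ} (b : Fin d → Bool) : ℕ := (Finset.univ.filter fun j => b j = true).card

/-- The value `0` or `1` of a Boolean. -/
def boolValue (b : Bool) : ℝ := if b then 1 else 0

/-- If the expected number of successes is at most `s / 2`, then restricting to at most `s`
successes keeps at least half of the mean of a nonnegative linear combination. -/
theorem half_mean_le_sum_sparse {d s : ℕ} (hs : 1 ≤ s) {q c : Fin d → ℝ} (hq0 : ∀ j, 0 ≤ q j)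
    (hq1 : ∀ j, q j ≤ 1) (hqs : ∑ j, q j ≤ s / 2) (hc : ∀ j, 0 ≤ c j) :
    (∑ j, q j * c j) / 2 ≤
      ∑ b ∈ Finset.univ.filter (fun b : Fin d → Bool => successCount b ≤ s),
        (∏ j, bernoulliWeight (q j) (b j)) * ∑ j, c j * boolValue (b j) := by
  have hs0 : (0 : ℝ) < s := by exact_mod_cast hs
  set π : (Fin d → Bool) → ℝ := fun b => ∏ j, bernoulliWeight (q j) (b j) with hπ
  have hπ0 : ∀ b, 0 ≤ π b := fun b =>
    Finset.prod_nonneg fun j _ => bernoulliWeight_nonneg (hq0 j) (hq1 j) _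
  -- With N the number of successes, B_j 1{N ≤ s} ≥ B_j (1 - (N - 1)/s): if B_j = 1 and N > s, the
  -- right side is nonpositive. It involves only products of two coordinates, hence has an explicit
  -- mean.
  have hpt : ∀ b : Fin d → Bool, ∑ j, c j * (boolValue (b j) -
      (∑ i ∈ Finset.univ.erase j, boolValue (b j) * boolValue (b i)) / s) ≤
      if successCount b ≤ s then ∑ j, c j * boolValue (b j) else 0 := by
    intro b
    have hcount : (successCount b : ℝ) = ∑ j, boolValue (b j) := by
      simp [successCount, boolValue]
    have hbv : ∀ j, 0 ≤ boolValue (b j) := fun j => by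
      unfold boolValue; split_ifs <;> norm_num
    split_ifs with hb
    · refine Finset.sum_le_sum fun j _ => mul_le_mul_of_nonneg_left ?_ (hc j)
      have : 0 ≤ (∑ i ∈ Finset.univ.erase j, boolValue (b j) * boolValue (b i)) / s :=
        div_nonneg (Finset.sum_nonneg fun i _ => mul_nonneg (hbv j) (hbv i)) hs0.le
      linarith
    · refine Finset.sum_nonpos fun j _ => mul_nonpos_of_nonneg_of_nonpos (hc j) ?_
      cases hj : b j
      · simp [boolValue]
      · have h1 : ∑ j, boolValue (b j) = ∑ i ∈ Finset.univ.erase j, boolValue (b i) + 1 := by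
          rw [← Finset.sum_erase_add _ _ (Finset.mem_univ j), hj]; simp [boolValue]
        have h2 : (s : ℝ) + 1 ≤ successCount b := by exact_mod_cast not_le.mp hb
        have h3 : (1 : ℝ) ≤ (∑ i ∈ Finset.univ.erase j, boolValue (b i)) / s := by
          rw [le_div_iff₀ hs0]; linarith
        simpa [boolValue] using h3
  rw [Finset.sum_filter]
  calc (∑ j, q j * c j) / 2
      ≤ ∑ j, c j * (q j - (∑ i ∈ Finset.univ.erase j, q j * q i) / s) := by
        rw [Finset.sum_div]
        refine Finset.sum_le_sum fun j _ => ?_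
        have h1 : (∑ i ∈ Finset.univ.erase j, q j * q i) / s ≤ q j / 2 := by
          rw [← Finset.mul_sum, div_le_iff₀ hs0]
          have : ∑ i ∈ Finset.univ.erase j, q i ≤ ∑ i, q i :=
            Finset.sum_le_univ_sum_of_nonneg hq0
          nlinarith [hq0 j]
        nlinarith [hc j]
    _ = ∑ b, π b * ∑ j, c j * (boolValue (b j) -
          (∑ i ∈ Finset.univ.erase j, boolValue (b j) * boolValue (b i)) / s) := by
        have hb : ∀ q : ℝ, ∑ z, bernoulliWeight q z * boolValue z = q := fun q => by
          simp [bernoulliWeight, boolValue]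
        simp only [Finset.mul_sum]
        rw [Finset.sum_comm]
        refine Finset.sum_congr rfl fun j _ => ?_
        have e1 : ∑ b, π b * boolValue (b j) = q j := by
          rw [hπ, sum_prod_pi_mul_apply (fun j => sum_bernoulliWeight (q j)), hb]
        have e2 : ∀ i ∈ Finset.univ.erase j,
            ∑ b, π b * (boolValue (b j) * boolValue (b i)) = q j * q i := fun i hi => by
          rw [hπ, sum_prod_pi_mul_apply_mul_apply (fun j => sum_bernoulliWeight (q j))
            (Finset.ne_of_mem_erase hi).symm, hb, hb]
        have e3 : ∑ b, π b * ((∑ i ∈ Finset.univ.erase j, boolValue (b j) * boolValue (b i)) / s)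
            = (∑ i ∈ Finset.univ.erase j, q j * q i) / s := by
          rw [← Finset.sum_congr rfl e2, Finset.sum_comm, Finset.sum_div]
          refine Finset.sum_congr rfl fun b _ => ?_
          rw [← mul_div_assoc, Finset.mul_sum]
        rw [← e3, ← e1, ← Finset.sum_sub_distrib, Finset.mul_sum]
        exact Finset.sum_congr rfl fun b _ => by ring
    _ ≤ _ := by
        refine Finset.sum_le_sum fun b _ => ?_
        refine (mul_le_mul_of_nonneg_left (hpt b) (hπ0 b)).trans (le_of_eq ?_)
        split_ifs <;> simp [hπ]

/-! ### The least favourable noise -/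

/-- The support `{-2, 0, 2}` of the noise under the sparse prior. -/
def bulkValue : Fin 3 → ℝ := ![-2, 0, 2]

/-- The weights of the noise under the sparse prior. -/
def bulkWeight : Fin 3 → ℝ := ![1 / 8, 3 / 4, 1 / 8]

/-- The correction to the bulk that restores mean zero and unit variance of the null noise. -/
def bulkCorrection (q h : ℝ) : Fin 3 → ℝ :=
  ![(2 * q * h - q * h ^ 2) / 8, q * h ^ 2 / 4, (-2 * q * h - q * h ^ 2) / 8]

/-- The weights of the pair (noise, spike) under the sparse prior. -/
def priorWeight (q : ℝ) (z : Fin 3 × Bool) : ℝ := bulkWeight z.1 * bernoulliWeight q z.2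

/-- The weights of the null noise, which imitates the sum of the noise and the spike. -/
def nullWeight (q h : ℝ) (z : Fin 3 × Bool) : ℝ :=
  if z.2 then q * bulkWeight z.1 else (1 - q) * bulkWeight z.1 + bulkCorrection q h z.1

/-- The sum of the noise and the spike. -/
def spikedValue (h : ℝ) (z : Fin 3 × Bool) : ℝ := bulkValue z.1 + h * boolValue z.2

/-- The squared prior weights over the null weights. -/
def weightRatio (q h : ℝ) (z : Fin 3 × Bool) : ℝ :=
  if z.2 then q * bulkWeight z.1 else ((1 - q) * bulkWeight z.1) ^ 2 / nullWeight q h z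

theorem bulkWeight_nonneg (a : Fin 3) : 0 ≤ bulkWeight a := by
  fin_cases a <;> norm_num [bulkWeight]

theorem sum_bulkWeight : ∑ a, bulkWeight a = 1 := by
  simp [bulkWeight, Fin.sum_univ_three]
  norm_num

theorem abs_bulkValue_le (a : Fin 3) : |bulkValue a| ≤ 2 := by
  fin_cases a <;> norm_num [bulkValue]

theorem priorWeight_nonneg {q : ℝ} (h0 : 0 ≤ q) (h1 : q ≤ 1) (z : Fin 3 × Bool) :
    0 ≤ priorWeight q z :=
  mul_nonneg (bulkWeight_nonneg _) (bernoulliWeight_nonneg h0 h1 _)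

theorem sum_priorWeight (q : ℝ) : ∑ z, priorWeight q z = 1 := by
  simp only [priorWeight, Fintype.sum_prod_type, ← Finset.mul_sum, sum_bernoulliWeight, mul_one,
    sum_bulkWeight]

/-- The constraints on the spike probability `q` and the spike height `h`. -/
structure IsSpike (q h : ℝ) : Prop where
  nonneg : 0 ≤ q
  le_quarter : q ≤ 1 / 4
  mul_abs_le : q * |h| ≤ 1 / 16
  mul_sq_le : q * h ^ 2 ≤ 1 / 16

/-- An outer atom keeps at least (3/4)(1/8) and loses at most (3/16)/8, which leaves 9/128; the
middle atom only gains from its correction. -/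
theorem IsSpike.nullWeight_false_ge {q h : ℝ} (H : IsSpike q h) (a : Fin 3) :
    1 / 16 ≤ nullWeight q h (a, false) := by
  have h1 := H.mul_sq_le
  have h2 := H.le_quarter
  have h3 : |q * h| ≤ 1 / 16 := by rw [abs_mul, abs_of_nonneg H.nonneg]; exact H.mul_abs_le
  have h4 := abs_le.mp h3
  have h5 : 0 ≤ q * h ^ 2 := mul_nonneg H.nonneg (sq_nonneg _)
  fin_cases a <;> simp [nullWeight, bulkWeight, bulkCorrection] <;> linarith [h4.1, h4.2]

theorem IsSpike.nullWeight_nonneg {q h : ℝ} (H : IsSpike q h) (z : Fin 3 × Bool) :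
    0 ≤ nullWeight q h z := by
  obtain ⟨a, b⟩ := z
  cases b
  · linarith [H.nullWeight_false_ge a]
  · simpa [nullWeight] using mul_nonneg H.nonneg (bulkWeight_nonneg a)

theorem sum_nullWeight (q h : ℝ) : ∑ z, nullWeight q h z = 1 := by
  simp [Fintype.sum_prod_type, Fin.sum_univ_three, nullWeight, bulkWeight, bulkCorrection]
  ring

theorem sum_nullWeight_mul_spikedValue (q h : ℝ) :
    ∑ z, nullWeight q h z * spikedValue h z = 0 := by
  simp [Fintype.sum_prod_type, Fin.sum_univ_three, nullWeight, bulkWeight, bulkCorrection,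
    spikedValue, bulkValue, boolValue]
  ring

theorem sum_nullWeight_mul_spikedValue_sq (q h : ℝ) :
    ∑ z, nullWeight q h z * spikedValue h z ^ 2 = 1 := by
  simp [Fintype.sum_prod_type, Fin.sum_univ_three, nullWeight, bulkWeight, bulkCorrection,
    spikedValue, bulkValue, boolValue]
  ring

theorem IsSpike.weightRatio_nonneg {q h : ℝ} (H : IsSpike q h) (z : Fin 3 × Bool) :
    0 ≤ weightRatio q h z := by
  unfold weightRatio
  split_ifs
  · exact mul_nonneg H.nonneg (bulkWeight_nonneg _)
  · exact div_nonneg (sq_nonneg _) (H.nullWeight_nonneg z)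

theorem IsSpike.priorWeight_sq {q h : ℝ} (H : IsSpike q h) (z : Fin 3 × Bool) :
    priorWeight q z ^ 2 = nullWeight q h z * weightRatio q h z := by
  obtain ⟨a, b⟩ := z
  cases b
  · have := H.nullWeight_false_ge a
    have h0 : nullWeight q h (a, false) ≠ 0 := by linarith
    simp only [priorWeight, bernoulliWeight, weightRatio, Bool.false_eq_true, if_false]
    field_simp
  · simp only [priorWeight, bernoulliWeight, weightRatio, nullWeight, if_true]
    ring

/-- The spike atoms contribute exactly q. On the others, with prior weight p and correction δ, p²/(p
+ δ) = p - δ + δ²/(p + δ). The corrections sum to zero, so only the quadratic term exceeds 1. -/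
theorem IsSpike.sum_weightRatio_le {q h : ℝ} (H : IsSpike q h) :
    ∑ z, weightRatio q h z ≤ Real.exp (2 * (q ^ 2 * (h ^ 2 + h ^ 4))) := by
  have hpt : ∀ a, weightRatio q h (a, false) ≤
      (1 - q) * bulkWeight a - bulkCorrection q h a + 16 * bulkCorrection q h a ^ 2 := by
    intro a
    have hv := H.nullWeight_false_ge a
    have hv0 : 0 < nullWeight q h (a, false) := by linarith
    have e : (1 - q) * bulkWeight a = nullWeight q h (a, false) - bulkCorrection q h a := by
      simp [nullWeight]
    have e2 : weightRatio q h (a, false) = (1 - q) * bulkWeight a - bulkCorrection q h a +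
        bulkCorrection q h a ^ 2 / nullWeight q h (a, false) := by
      simp only [weightRatio, Bool.false_eq_true, if_false]
      rw [e]; field_simp; ring
    rw [e2]
    have : bulkCorrection q h a ^ 2 / nullWeight q h (a, false) ≤
        16 * bulkCorrection q h a ^ 2 := by
      rw [div_le_iff₀ hv0]
      nlinarith [sq_nonneg (bulkCorrection q h a)]
    linarith
  have h0 := hpt 0
  have h1 := hpt 1
  have h2 := hpt 2
  refine le_trans ?_ (Real.add_one_le_exp _)
  simp only [Fintype.sum_prod_type, Fin.sum_univ_three, Fintype.sum_bool]
  have ht : ∀ a, weightRatio q h (a, true) = q * bulkWeight a := fun a => by simp [weightRatio]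
  rw [ht, ht, ht]
  simp only [bulkWeight, bulkCorrection, Matrix.cons_val_zero, Matrix.cons_val_one,
    Matrix.cons_val] at h0 h1 h2 ⊢
  nlinarith [sq_nonneg (q * h), sq_nonneg (q * h ^ 2)]

/-! ### Membership in the noise class -/

/-- The scale from which on the noise class contains the least favourable laws. -/
def tailScale (α : ℝ) : ℝ := 4 * 2 ^ (1 / α)

theorem four_le_tailScale {α : ℝ} (hα : 0 < α) : 4 ≤ tailScale α := by
  have : (1 : ℝ) ≤ 2 ^ (1 / α) := Real.one_le_rpow (by norm_num) (by positivity)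
  unfold tailScale; linarith

/-- The factor 2^(1/α) in `tailScale` makes (t/τ)^α ≤ 1/2, so that 2 exp(-1/2) ≥ 2 (1 - 1/2) = 1.
Tails up to t = 3 are therefore unconstrained. -/
theorem one_le_two_mul_exp {α τ t : ℝ} (hα : 0 < α) (hτ : tailScale α ≤ τ) (ht : 0 ≤ t)
    (ht3 : t ≤ 3) : 1 ≤ 2 * Real.exp (-(t / τ) ^ α) := by
  have h4 := four_le_tailScale hα
  have hp : (0 : ℝ) < 2 ^ (1 / α) := by positivity
  have h1 : t / τ ≤ (2 ^ (1 / α))⁻¹ := by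
    rw [div_le_iff₀ (by linarith), inv_mul_eq_div, le_div_iff₀ hp]
    unfold tailScale at hτ
    nlinarith
  have h2 : (t / τ) ^ α ≤ 1 / 2 := by
    calc (t / τ) ^ α ≤ ((2 ^ (1 / α))⁻¹) ^ α :=
          Real.rpow_le_rpow (div_nonneg ht (by linarith)) h1 hα.le
      _ = 1 / 2 := by
          rw [Real.inv_rpow hp.le, ← Real.rpow_mul (by norm_num), one_div_mul_cancel hα.ne',
            Real.rpow_one, one_div]
  have := Real.add_one_le_exp (-(t / τ) ^ α)
  linarith

theorem bulkLaw_mem_noiseClass {α τ : ℝ} (hα : 0 < α) (hτ : tailScale α ≤ τ) :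
    (finiteLaw bulkWeight).map bulkValue ∈ noiseClass α τ := by
  refine map_finiteLaw_mem_noiseClass bulkWeight_nonneg sum_bulkWeight ?_ ?_ fun t ht => ?_
  · simp [Fin.sum_univ_three, bulkWeight, bulkValue]
  · simp [Fin.sum_univ_three, bulkWeight, bulkValue]; norm_num
  · rcases le_or_gt t 3 with h3 | h3
    · refine le_trans ?_ (one_le_two_mul_exp hα hτ ht h3)
      rw [← sum_bulkWeight]
      refine Finset.sum_le_sum fun a _ => ?_
      split_ifs
      · exact le_rfl
      · exact bulkWeight_nonneg a
    · refine le_trans (le_of_eq (Finset.sum_eq_zero fun a _ => if_neg ?_)) (by positivity)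
      linarith [abs_bulkValue_le a]

theorem IsSpike.nullLaw_mem_noiseClass {α τ q h : ℝ} (H : IsSpike q h) (hα : 0 < α)
    (hτ : tailScale α ≤ τ) (htail : |h| ≤ 1 ∨ q ≤ Real.exp (-|h| ^ α)) :
    (finiteLaw (nullWeight q h)).map (spikedValue h) ∈ noiseClass α τ := by
  have h4 := four_le_tailScale hα
  refine map_finiteLaw_mem_noiseClass H.nullWeight_nonneg (sum_nullWeight q h)
    (sum_nullWeight_mul_spikedValue q h) (sum_nullWeight_mul_spikedValue_sq q h) fun t ht => ?_
  rcases le_or_gt t 3 with h3 | h3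
  · refine le_trans ?_ (one_le_two_mul_exp hα hτ ht h3)
    rw [← sum_nullWeight q h]
    refine Finset.sum_le_sum fun z _ => ?_
    split_ifs
    · exact le_rfl
    · exact H.nullWeight_nonneg z
  · set E := 2 * Real.exp (-(t / τ) ^ α) with hE
    have hE0 : 0 ≤ E := by positivity
    -- Beyond 3 only spike atoms remain, and then |h| > 1 and t ≤ 2 + |h| ≤ 4|h| ≤ τ|h|, so their
    -- total mass q is below the tail bound.
    have hterm : ∀ z : Fin 3 × Bool, (if t ≤ |spikedValue h z| then nullWeight q h z else 0) ≤
        bulkWeight z.1 * (boolValue z.2 * E) := by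
      rintro ⟨a, b⟩
      have ha := abs_bulkValue_le a
      split_ifs with hv
      · cases b
        · simp [spikedValue, boolValue] at hv
          linarith
        · have hv' : |bulkValue a + h| ≤ 2 + |h| := (abs_add_le _ _).trans (by linarith)
          simp only [spikedValue, boolValue, if_true, mul_one] at hv
          have hh : 1 < |h| := by linarith
          have hq := htail.resolve_left (not_le.mpr hh)
          have hle : (t / τ) ^ α ≤ |h| ^ α := by
            refine Real.rpow_le_rpow (div_nonneg ht (by linarith)) ?_ hα.le
            rw [div_le_iff₀ (by linarith)]
            nlinarith
          have hqE : q ≤ E := by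
            have h1 : Real.exp (-|h| ^ α) ≤ Real.exp (-(t / τ) ^ α) :=
              Real.exp_le_exp.mpr (neg_le_neg hle)
            have h2 := Real.exp_pos (-(t / τ) ^ α)
            rw [hE]; linarith
          simp only [nullWeight, boolValue, if_true, one_mul]
          rw [mul_comm]
          exact mul_le_mul_of_nonneg_left hqE (bulkWeight_nonneg a)
      · refine mul_nonneg (bulkWeight_nonneg a) (mul_nonneg ?_ hE0)
        unfold boolValue; split_ifs <;> norm_num
    refine (Finset.sum_le_sum fun z _ => hterm z).trans (le_of_eq ?_)
    simp only [Fintype.sum_prod_type, ← Finset.mul_sum, ← Finset.sum_mul, sum_bulkWeight]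
    simp [boolValue]

/-! ### The general lower bound -/

theorem toReal_le_of_meanSquaredError {Ω : Type*} [Fintype Ω] [MeasurableSpace Ω]
    [DiscreteMeasurableSpace Ω] {d : ℕ} {w v : Fin d → Ω → ℝ} (hw : ∀ j x, 0 ≤ w j x)
    {σ r : ℝ} (hr : 0 ≤ r) {η θ : Fin d → ℝ} {T : (Fin d → ℝ) → ℝ} (hT : Measurable T)
    (h : meanSquaredError σ η θ (Measure.pi fun j => (finiteLaw (w j)).map (v j)) T ≤
      ENNReal.ofReal r) :
    ∑ x : Fin d → Ω, (∏ j, w j (x j)) *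
      (T (fun j => θ j + σ * v j (x j)) - linearFunctional η θ) ^ 2 ≤ r := by
  rw [meanSquaredError_finiteLaw hw σ η θ hT] at h
  exact (ENNReal.ofReal_le_ofReal_iff hr).mp h

/-- Lower bound on the minimax risk by spikes of height `h j` appearing with probability `q j`. -/
theorem le_minimaxRisk_of_isSpike {α τ σ C : ℝ} {d s : ℕ} {η q h : Fin d → ℝ} (hα : 0 < α)
    (hτ : tailScale α ≤ τ) (hσ : 0 < σ) (hs : 1 ≤ s) (H : ∀ j, IsSpike (q j) (h j))
    (htail : ∀ j, |h j| ≤ 1 ∨ q j ≤ Real.exp (-|h j| ^ α)) (hsign : ∀ j, 0 ≤ η j * h j)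
    (hqs : ∑ j, q j ≤ s / 2) (hC : ∑ j, q j ^ 2 * (h j ^ 2 + h j ^ 4) ≤ C) :
    ENNReal.ofReal (σ ^ 2 * (∑ j, q j * (η j * h j)) ^ 2 / (4 * (1 + Real.exp C) ^ 2)) ≤
      minimaxRisk α τ σ s η := by
  classical
  refine le_iInf₂ fun T hT => ?_
  set R := ⨆ (θ ∈ sparseVectors d s) (Q ∈ noiseProductClass d α τ), meanSquaredError σ η θ Q T
    with hR
  rcases eq_or_ne R ⊤ with htop | htop
  · rw [htop]; exact le_top
  set r := R.toReal with hr
  have hr0 : 0 ≤ r := ENNReal.toReal_nonneg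
  have hRr : R = ENNReal.ofReal r := (ENNReal.ofReal_toReal htop).symm
  have hle : ∀ θ ∈ sparseVectors d s, ∀ Q ∈ noiseProductClass d α τ,
      meanSquaredError σ η θ Q T ≤ ENNReal.ofReal r := fun θ hθ Q hQ => by
    rw [← hRr, hR]
    exact le_iSup₂_of_le θ hθ (le_iSup₂_of_le Q hQ le_rfl)
  have hq1 : ∀ j, q j ≤ 1 := fun j => by linarith [(H j).le_quarter]
  have hr₀ := toReal_le_of_meanSquaredError (fun j => (H j).nullWeight_nonneg) hr0 hT
    (hle 0 (by simp [sparseVectors]) _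
      ⟨_, fun j => (H j).nullLaw_mem_noiseClass hα hτ (htail j), rfl⟩)
  set θ : (Fin d → Bool) → Fin d → ℝ := fun b j => σ * (h j * boolValue (b j)) with hθ
  have hθs : ∀ b, successCount b ≤ s → θ b ∈ sparseVectors d s := fun b hb => by
    refine le_trans (Finset.card_le_card fun j hj => ?_) hb
    simp only [Finset.mem_filter, Finset.mem_univ, true_and] at hj ⊢
    by_contra hbj
    exact hj (by simp [hθ, boolValue, hbj])
  have hr₁ : ∀ b, successCount b ≤ s → ∑ a : Fin d → Fin 3, (∏ j, bulkWeight (a j)) *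
      (T (fun j => θ b j + σ * bulkValue (a j)) - linearFunctional η (θ b)) ^ 2 ≤ r :=
    fun b hb => toReal_le_of_meanSquaredError (fun _ => bulkWeight_nonneg) hr0 hT
      (hle _ (hθs b hb) _ ⟨_, fun _ => bulkLaw_mem_noiseClass hα hτ, rfl⟩)
  set S : Finset (Fin d → Bool) := Finset.univ.filter fun b => successCount b ≤ s with hS
  set π : (Fin d → Bool) → ℝ := fun b => ∏ j, bernoulliWeight (q j) (b j) with hπ
  have hπ0 : ∀ b, 0 ≤ π b := fun b =>
    Finset.prod_nonneg fun j _ => bernoulliWeight_nonneg (H j).nonneg (hq1 j) _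
  have hπ1 : ∑ b, π b = 1 := by
    rw [hπ, sum_prod_pi]; simp only [sum_bernoulliWeight, Finset.prod_const_one]
  have hA1 : ∑ a : Fin d → Fin 3, ∏ j, bulkWeight (a j) = 1 := by
    rw [sum_prod_pi fun _ => bulkWeight]; simp only [sum_bulkWeight, Finset.prod_const_one]
  -- In the latent variables (a, b) the observation is the same function σ (bulk + h b) under both
  -- experiments; only the weights differ, so data-dependent `T` becomes one fixed function.
  let e := Equiv.arrowProdEquivProdArrow (Fin d) (fun _ => Fin 3) (fun _ => Bool)
  have hsumS : ∀ F : (Fin d → Fin 3 × Bool) → ℝ,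
      ∑ x ∈ Finset.univ.filter (fun x => (e x).2 ∈ S), F x =
        ∑ b ∈ S, ∑ a, F (e.symm (a, b)) := fun F => by
    rw [Finset.sum_filter, ← e.symm.sum_comp, Fintype.sum_prod_type_right]
    simp only [Equiv.apply_symm_apply]
    rw [← Finset.sum_subset (Finset.subset_univ S)]
    · exact Finset.sum_congr rfl fun b hb => Finset.sum_congr rfl fun a _ => if_pos hb
    · exact fun b _ hb => Finset.sum_eq_zero fun a _ => if_neg hb
  have hw₁ : ∀ a b, ∏ j, priorWeight (q j) (e.symm (a, b) j) =
      π b * ∏ j, bulkWeight (a j) := fun a b => by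
    rw [mul_comm, hπ, ← Finset.prod_mul_distrib]; rfl
  have key := sum_mul_le_of_risk_le (Finset.univ.filter fun x => (e x).2 ∈ S)
    (w₀ := fun x => ∏ j, nullWeight (q j) (h j) (x j))
    (w₁ := fun x => ∏ j, priorWeight (q j) (x j))
    (g := fun x => ∏ j, weightRatio (q j) (h j) (x j))
    (T := fun x => T fun j => σ * spikedValue (h j) (x j))
    (L := fun x => linearFunctional η (θ (e x).2)) (r := r) (K := Real.exp C ^ 2)
    (fun x => Finset.prod_nonneg fun j _ => (H j).nullWeight_nonneg _)
    (fun x => Finset.prod_nonneg fun j _ => priorWeight_nonneg (H j).nonneg (hq1 j) _)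
    (fun x => Finset.prod_nonneg fun j _ => (H j).weightRatio_nonneg _)
    (fun x => le_of_eq <| by
      simp only [← Finset.prod_pow, ← Finset.prod_mul_distrib, (H _).priorWeight_sq])
    (by rw [sum_prod_pi]; simp only [sum_priorWeight, Finset.prod_const_one, le_refl])
    (by
      rw [sum_prod_pi, ← Real.exp_nat_mul]
      refine (Finset.prod_le_prod (fun j _ => Finset.sum_nonneg fun z _ =>
        (H j).weightRatio_nonneg z) fun j _ => (H j).sum_weightRatio_le).trans ?_
      rw [← Real.exp_sum, ← Finset.mul_sum]
      exact Real.exp_le_exp.mpr (by push_cast; linarith))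
    (by simpa [linearFunctional] using hr₀)
    (by
      rw [hsumS]
      simp only [hw₁]
      calc _ = ∑ b ∈ S, π b * ∑ a : Fin d → Fin 3, (∏ j, bulkWeight (a j)) *
            (T (fun j => θ b j + σ * bulkValue (a j)) - linearFunctional η (θ b)) ^ 2 := by
            refine Finset.sum_congr rfl fun b _ => ?_
            rw [Finset.mul_sum]
            refine Finset.sum_congr rfl fun a _ => ?_
            rw [mul_assoc]
            congr 4
            · congr 1
              funext j
              change σ * (bulkValue (a j) + h j * boolValue (b j)) =
                σ * (h j * boolValue (b j)) + σ * bulkValue (a j)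
              ring
        _ ≤ ∑ b ∈ S, π b * r := Finset.sum_le_sum fun b hb =>
            mul_le_mul_of_nonneg_left (hr₁ b (by simpa [hS] using hb)) (hπ0 b)
        _ ≤ 1 * r := by
            rw [← Finset.sum_mul, ← hπ1]
            exact mul_le_mul_of_nonneg_right (Finset.sum_le_univ_sum_of_nonneg hπ0) hr0
        _ = r := one_mul r)
  have hlow := half_mean_le_sum_sparse hs (c := fun j => η j * h j) (fun j => (H j).nonneg) hq1
    hqs hsign
  -- The restricted mean of L is at least σ m / 2 with m = ∑ q_j η_j h_j, while `key` bounds it by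
  -- √r (1 + exp C).
  rw [hsumS] at key
  have hL : ∑ b ∈ S, ∑ a, (∏ j, priorWeight (q j) (e.symm (a, b) j)) *
      linearFunctional η (θ (e (e.symm (a, b))).2) =
      σ * ∑ b ∈ S, π b * ∑ j, η j * h j * boolValue (b j) := by
    rw [Finset.mul_sum]
    refine Finset.sum_congr rfl fun b _ => ?_
    simp only [hw₁, Equiv.apply_symm_apply]
    rw [← Finset.sum_mul, ← Finset.mul_sum, hA1, mul_one]
    simp only [linearFunctional, hθ, Finset.mul_sum]
    exact Finset.sum_congr rfl fun j _ => by ring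
  rw [hL, Real.sqrt_mul hr0, Real.sqrt_sq (Real.exp_pos C).le] at key
  set m := ∑ j, q j * (η j * h j) with hm
  have hm0 : 0 ≤ m := Finset.sum_nonneg fun j _ => mul_nonneg (H j).nonneg (hsign j)
  have hmr : σ * (m / 2) ≤ √r * (1 + Real.exp C) := by
    have := mul_le_mul_of_nonneg_left hlow hσ.le
    linarith
  rw [hRr]
  refine ENNReal.ofReal_le_ofReal ?_
  have hC0 := Real.exp_pos C
  rw [div_le_iff₀ (by positivity)]
  have hsq := pow_le_pow_left₀ (by positivity) hmr 2
  rw [mul_pow (√r), Real.sq_sqrt hr0] at hsq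
  nlinarith

/-! ### Spikes of constant contribution -/

/-- For u ≥ 1 and n ≥ 4/α, u⁴ ≤ (u^α)^n ≤ n! exp(u^α). -/
theorem exists_pow_four_mul_exp_neg_rpow_le {α : ℝ} (hα : 0 < α) :
    ∃ K : ℝ, 1 ≤ K ∧ ∀ u : ℝ, 0 ≤ u → u ^ 4 * Real.exp (-u ^ α) ≤ K := by
  obtain ⟨n, hn⟩ := exists_nat_ge (4 / α)
  have hn0 : (1 : ℝ) ≤ (n.factorial : ℝ) := by exact_mod_cast n.factorial_pos
  refine ⟨n.factorial, hn0, fun u hu => ?_⟩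
  have hx : 0 ≤ u ^ α := Real.rpow_nonneg hu α
  rw [Real.exp_neg, ← div_eq_mul_inv, div_le_iff₀ (Real.exp_pos _)]
  rcases le_total u 1 with h1 | h1
  · calc u ^ 4 ≤ 1 := pow_le_one₀ hu h1
      _ ≤ n.factorial * Real.exp (u ^ α) := by
        nlinarith [Real.one_le_exp hx]
  · have h2 : u ^ 4 ≤ (u ^ α) ^ n := by
      rw [← Real.rpow_natCast, ← Real.rpow_natCast (u ^ α) n, ← Real.rpow_mul hu]
      refine Real.rpow_le_rpow_of_exponent_le h1 ?_
      push_cast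
      rw [div_le_iff₀ hα] at hn
      linarith
    have h3 := Real.pow_div_factorial_le_exp (u ^ α) hx n
    rw [div_le_iff₀ (by linarith)] at h3
    linarith

/-- A factor `κ` such that spikes of height `κ u` and probability `exp (-u ^ α) / 4` are
admissible for every `u ≥ 0`. -/
structure IsHeightFactor (α κ : ℝ) : Prop where
  pos : 0 < κ
  le_one : κ ≤ 1
  mul_le : ∀ u : ℝ, 0 ≤ u → (κ * u) * Real.exp (-u ^ α) ≤ 1 / 4
  add_le : ∀ u : ℝ, 0 ≤ u → ((κ * u) ^ 2 + (κ * u) ^ 4) * Real.exp (-u ^ α) ≤ 1 / 4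

theorem exists_isHeightFactor {α : ℝ} (hα : 0 < α) : ∃ κ, IsHeightFactor α κ := by
  obtain ⟨K, hK, hb⟩ := exists_pow_four_mul_exp_neg_rpow_le hα
  -- The 12 is set by the sharper constraint: κ (1 + 2K) ≤ 3 κ K = 1/4.
  have hκ1 : 1 / (12 * K) ≤ 1 := by
    rw [div_le_one (by linarith)]; linarith
  have hκK : 1 / (12 * K) * K = 1 / 12 := by field_simp
  have hκ0 : 0 < 1 / (12 * K) := by positivity
  set κ := 1 / (12 * K)
  have hp : ∀ u : ℝ, 0 ≤ u → 0 < Real.exp (-u ^ α) ∧ Real.exp (-u ^ α) ≤ 1 := fun u hu =>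
    ⟨Real.exp_pos _, Real.exp_le_one_iff.mpr (neg_nonpos.mpr (Real.rpow_nonneg hu α))⟩
  have hκ2 : κ ^ 2 ≤ κ := by nlinarith
  have hκ4 : κ ^ 4 ≤ κ := by nlinarith [mul_nonneg hκ0.le hκ0.le]
  refine ⟨κ, hκ0, hκ1, fun u hu => ?_, fun u hu => ?_⟩
  · obtain ⟨h0, h1⟩ := hp u hu
    have h2 : u ≤ 1 + u ^ 4 := by nlinarith [sq_nonneg (u ^ 2 - 1), sq_nonneg (u - 1)]
    have h3 : u * Real.exp (-u ^ α) ≤ 1 + K := by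
      nlinarith [mul_le_mul_of_nonneg_right h2 h0.le, hb u hu]
    nlinarith [mul_le_mul_of_nonneg_left h3 hκ0.le, mul_le_mul_of_nonneg_left hK hκ0.le]
  · obtain ⟨h0, h1⟩ := hp u hu
    have h2 : u ^ 2 ≤ 1 + u ^ 4 := by nlinarith [sq_nonneg (u ^ 2 - 1)]
    have h3 : (u ^ 2 + u ^ 4) * Real.exp (-u ^ α) ≤ 1 + 2 * K := by
      nlinarith [mul_le_mul_of_nonneg_right h2 h0.le, hb u hu]
    have h4 : (κ * u) ^ 2 + (κ * u) ^ 4 ≤ κ * (u ^ 2 + u ^ 4) := by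
      rw [mul_pow, mul_pow]
      nlinarith [mul_le_mul_of_nonneg_right hκ2 (sq_nonneg u),
        mul_le_mul_of_nonneg_right hκ4 (show 0 ≤ u ^ 4 by positivity)]
    nlinarith [mul_le_mul_of_nonneg_right h4 h0.le, mul_le_mul_of_nonneg_left h3 hκ0.le,
      mul_le_mul_of_nonneg_left hK hκ0.le]

/-- Lower bound by spikes that all contribute `κ * l` to the functional. -/
theorem le_minimaxRisk_of_isHeightFactor {α τ σ κ l C : ℝ} {d s : ℕ} {η q : Fin d → ℝ}
    (hα : 0 < α) (hτ : tailScale α ≤ τ) (hσ : 0 < σ) (hs : 1 ≤ s) (hκ : IsHeightFactor α κ)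
    (hl : 0 ≤ l) (hη : ∀ j, η j ≠ 0) (hq0 : ∀ j, 0 ≤ q j)
    (hq : ∀ j, q j ≤ Real.exp (-|l / η j| ^ α) / 4) (hqs : ∑ j, q j ≤ s / 2)
    (hC : ∑ j, q j ^ 2 * ((κ * |l / η j|) ^ 2 + (κ * |l / η j|) ^ 4) ≤ C) :
    ENNReal.ofReal (σ ^ 2 * (κ * l * ∑ j, q j) ^ 2 / (4 * (1 + Real.exp C) ^ 2)) ≤
      minimaxRisk α τ σ s η := by
  have habs : ∀ j, |κ * (l / η j)| = κ * |l / η j| := fun j => by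
    rw [abs_mul, abs_of_pos hκ.pos]
  have hsq : ∀ j, (κ * (l / η j)) ^ 2 = (κ * |l / η j|) ^ 2 := fun j => by
    rw [← habs, sq_abs]
  have hηh : ∀ j, η j * (κ * (l / η j)) = κ * l := fun j => by
    have := hη j
    field_simp
  have hu : ∀ j, 0 ≤ |l / η j| := fun j => abs_nonneg _
  have key := le_minimaxRisk_of_isSpike (C := C) (h := fun j => κ * (l / η j)) (η := η) hα hτ hσ hs
    (fun j => ?_) (fun j => ?_) (fun j => ?_) hqs ?_
  · simp only [hηh, ← Finset.sum_mul] at key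
    rwa [mul_comm (κ * l)]
  · have h1 := hκ.mul_le _ (hu j)
    have h2 := hκ.add_le _ (hu j)
    have h3 : Real.exp (-|l / η j| ^ α) ≤ 1 :=
      Real.exp_le_one_iff.mpr (neg_nonpos.mpr (Real.rpow_nonneg (hu j) α))
    have hx : 0 ≤ κ * |l / η j| := mul_nonneg hκ.pos.le (hu j)
    refine ⟨hq0 j, by linarith [hq j], ?_, ?_⟩
    · rw [habs]
      nlinarith [mul_le_mul_of_nonneg_right (hq j) hx]
    · rw [hsq]
      have : 0 ≤ (κ * |l / η j|) ^ 4 * Real.exp (-|l / η j| ^ α) := by positivity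
      nlinarith [mul_le_mul_of_nonneg_right (hq j) (sq_nonneg (κ * |l / η j|))]
  · right
    refine (hq j).trans ?_
    rw [habs]
    have h1 : (κ * |l / η j|) ^ α ≤ |l / η j| ^ α :=
      Real.rpow_le_rpow (mul_nonneg hκ.pos.le (hu j))
        (mul_le_of_le_one_left (hu j) hκ.le_one) hα.le
    have h2 := Real.exp_le_exp.mpr (neg_le_neg h1)
    linarith [Real.exp_pos (-|l / η j| ^ α)]
  · rw [hηh]; exact mul_nonneg hκ.pos.le hl
  · refine le_trans (le_of_eq (Finset.sum_congr rfl fun j _ => ?_)) hC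
    have : (κ * (l / η j)) ^ 4 = (κ * |l / η j|) ^ 4 := by
      rw [show (4 : ℕ) = 2 * 2 from rfl, pow_mul, pow_mul, hsq]
    rw [hsq, this]

/-! ### The symmetric rate -/

theorem oracleLambda_nonneg (α : ℝ) (s : ℕ) {d : ℕ} (η : Fin d → ℝ) : 0 ≤ oracleLambda α s η :=
  Real.rpow_nonneg (le_max_right _ _) _

theorem oracleLambda_div_rpow {α : ℝ} (hα : 0 < α) (s : ℕ) {d : ℕ} (η : Fin d → ℝ) (j : Fin d) :
    (oracleLambda α s η / |η j|) ^ α = max (oracleBeta α s η) 0 / |η j| ^ α := by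
  rw [Real.div_rpow (oracleLambda_nonneg α s η) (abs_nonneg _), oracleLambda,
    ← Real.rpow_mul (le_max_right _ _), one_div_mul_cancel hα.ne', Real.rpow_one]

/-- The weights `exp (-(λ_o / |η_j|) ^ α)`. -/
def oracleWeight (α : ℝ) (s : ℕ) {d : ℕ} (η : Fin d → ℝ) (j : Fin d) : ℝ :=
  Real.exp (-(oracleLambda α s η / |η j|) ^ α)

theorem oracleRatio_max_eq {α : ℝ} (hα : 0 < α) (s : ℕ) {d : ℕ} (η : Fin d → ℝ) :
    oracleRatio α η (max (oracleBeta α s η) 0) =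
      (∑ j, |η j| * oracleWeight α s η j) / oracleNu α s η := by
  simp only [oracleRatio, oracleNu, oracleWeight, oracleLambda_div_rpow hα, neg_div]

theorem oracleBeta_spec {α : ℝ} (hα : 0 < α) {d s : ℕ} {η : Fin d → ℝ} (hd : 0 < d)
    (hη : ∀ j, η j ≠ 0) (hs : 1 ≤ s) : oracleRatio α η (oracleBeta α s η) = s / 2 :=
  Classical.epsilon_spec (existsUnique_oracleBeta hα hd hη hs).exists

section Oracle

variable {α : ℝ} {d s : ℕ} {η : Fin d → ℝ}

theorem oracleWeight_pos (α : ℝ) (s : ℕ) (η : Fin d → ℝ) (j : Fin d) : 0 < oracleWeight α s η j :=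
  Real.exp_pos _

theorem oracleWeight_le_one (j : Fin d) : oracleWeight α s η j ≤ 1 :=
  Real.exp_le_one_iff.mpr (neg_nonpos.mpr
    (Real.rpow_nonneg (div_nonneg (oracleLambda_nonneg α s η) (abs_nonneg _)) α))

theorem oracleNu_sq : oracleNu α s η ^ 2 = ∑ j, η j ^ 2 * oracleWeight α s η j :=
  Real.sq_sqrt (Finset.sum_nonneg fun _ _ => by positivity)

theorem oracleNu_pos (hd : 0 < d) (hη : ∀ j, η j ≠ 0) : 0 < oracleNu α s η := by
  have : Nonempty (Fin d) := ⟨⟨0, hd⟩⟩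
  exact Real.sqrt_pos.mpr (Finset.sum_pos (fun j _ => by have := hη j; positivity)
    Finset.univ_nonempty)

/-- The ratio decreases in β, and truncating β at 0 can only increase it. -/
theorem sum_div_oracleNu_le (hα : 0 < α) (hd : 0 < d) (hη : ∀ j, η j ≠ 0) (hs : 1 ≤ s) :
    (∑ j, |η j| * oracleWeight α s η j) / oracleNu α s η ≤ s / 2 := by
  rw [← oracleRatio_max_eq hα, ← oracleBeta_spec hα hd hη hs]
  exact (oracleRatio_strictAnti hα hd hη).antitone (le_max_left _ _)

/-- A nonzero λ_o means β > 0, so the defining equation holds without truncation; Cauchy–Schwarz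
then gives (s/2) ν = ∑ |η_j| p_j ≤ √(∑ p_j) ν. -/
theorem sq_div_four_le_sum_oracleWeight (hα : 0 < α) (hd : 0 < d) (hη : ∀ j, η j ≠ 0)
    (hs : 1 ≤ s) (hl : oracleLambda α s η ≠ 0) :
    (s : ℝ) ^ 2 / 4 ≤ ∑ j, oracleWeight α s η j := by
  have hν := oracleNu_pos (α := α) (s := s) hd hη
  have hmax : max (oracleBeta α s η) 0 = oracleBeta α s η := by
    refine max_eq_left (le_of_not_gt fun h => hl ?_)
    rw [oracleLambda, max_eq_right h.le, Real.zero_rpow (one_div_ne_zero hα.ne')]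
  have h1 := oracleRatio_max_eq hα s η
  rw [hmax, oracleBeta_spec hα hd hη hs, eq_div_iff hν.ne'] at h1
  have h2 : (∑ j, |η j| * oracleWeight α s η j) ^ 2 ≤
      (∑ j, oracleWeight α s η j) * ∑ j, η j ^ 2 * oracleWeight α s η j :=
    Finset.sum_sq_le_sum_mul_sum_of_sq_le_mul _ (fun j _ => (oracleWeight_pos α s η j).le)
      (fun j _ => mul_nonneg (sq_nonneg _) (oracleWeight_pos α s η j).le)
      fun j _ => le_of_eq (by rw [mul_pow, sq_abs]; ring)
  rw [← h1, ← oracleNu_sq, mul_pow] at h2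
  have h3 := le_of_mul_le_mul_right h2 (pow_pos hν 2)
  linarith

theorem oracleNu_le_minimaxRisk {τ σ : ℝ} (hα : 0 < α) (hτ : tailScale α ≤ τ) (hσ : 0 < σ)
    (hd : 0 < d) (hη : ∀ j, η j ≠ 0) (hs : 1 ≤ s) :
    ENNReal.ofReal (σ ^ 2 * (oracleNu α s η / 16) ^ 2 / (4 * (1 + Real.exp 1) ^ 2)) ≤
      minimaxRisk α τ σ s η := by
  have hν := oracleNu_pos (α := α) (s := s) hd hη
  set ν := oracleNu α s η with hν'
  set p := oracleWeight α s η with hp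
  have hp0 : ∀ j, 0 < p j := oracleWeight_pos α s η
  have hp1 : ∀ j, p j ≤ 1 := oracleWeight_le_one
  have hν2 : ν ^ 2 = ∑ j, η j ^ 2 * p j := oracleNu_sq
  have hpp : ∀ j, (|η j| * p j) ^ 2 ≤ η j ^ 2 * p j := fun j => by
    rw [mul_pow, sq_abs]
    exact mul_le_mul_of_nonneg_left (by nlinarith [hp0 j, hp1 j]) (sq_nonneg _)
  have hle : ∀ j, |η j| * p j ≤ ν := fun j => by
    refine le_of_sq_le_sq ((hpp j).trans ?_) hν.le
    rw [hν2]
    exact Finset.single_le_sum (f := fun j => η j ^ 2 * p j)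
      (fun i _ => mul_nonneg (sq_nonneg _) (hp0 i).le) (Finset.mem_univ j)
  have habs : ∀ j, |(|η j| / η j / 4)| = 1 / 4 := fun j => by
    rw [abs_div, abs_div, abs_abs, div_self (abs_ne_zero.mpr (hη j))]; norm_num
  have hsq : ∀ j, (|η j| / η j / 4) ^ 2 = 1 / 16 := fun j => by
    rw [← sq_abs, habs]; norm_num
  have hηh : ∀ j, η j * (|η j| / η j / 4) = |η j| / 4 := fun j => by
    have := hη j
    field_simp
  have hq0 : ∀ j, 0 ≤ |η j| * p j / (4 * ν) := fun j => by
    have := hp0 j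
    positivity
  have hq4 : ∀ j, |η j| * p j / (4 * ν) ≤ 1 / 4 := fun j => by
    rw [div_le_iff₀ (by positivity)]; linarith [hle j]
  -- Heights ±1/4 meet the tail condition whatever q is. The spike mass is the oracle ratio over 4,
  -- hence at most s/8, and the mean is ∑ η_j² p_j / (16 ν) = ν/16.
  have key := le_minimaxRisk_of_isSpike (C := 1) (h := fun j => |η j| / η j / 4) (η := η)
    (q := fun j => |η j| * p j / (4 * ν)) hα hτ hσ hs
    (fun j => ⟨hq0 j, hq4 j, ?_, ?_⟩) (fun j => Or.inl ?_) (fun j => ?_) ?_ ?_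
  · have e : ∑ j, |η j| * p j / (4 * ν) * (η j * (|η j| / η j / 4)) = ν / 16 := by
      have h1 : ∀ j, |η j| * p j / (4 * ν) * (η j * (|η j| / η j / 4)) =
          η j ^ 2 * p j / (16 * ν) := fun j => by
        rw [hηh, ← sq_abs (η j)]; field_simp; ring
      simp only [h1]
      rw [← Finset.sum_div, ← hν2]
      field_simp
    rwa [e] at key
  · rw [habs]; linarith [hq4 j]
  · rw [hsq]; linarith [hq4 j]
  · rw [habs]; norm_num
  · rw [hηh]; positivity
  · have h1 := sum_div_oracleNu_le hα hd hη hs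
    have h2 : ∑ j, |η j| * p j / (4 * ν) = (∑ j, |η j| * p j) / ν / 4 := by
      rw [← Finset.sum_div, div_div, mul_comm 4 ν]
    have h3 : (0 : ℝ) ≤ s := Nat.cast_nonneg s
    rw [h2]; linarith
  · have h1 : ∀ j, (|η j| * p j / (4 * ν)) ^ 2 *
        ((|η j| / η j / 4) ^ 2 + (|η j| / η j / 4) ^ 4) ≤ η j ^ 2 * p j / ν ^ 2 := fun j => by
      rw [show (|η j| / η j / 4) ^ 4 = ((|η j| / η j / 4) ^ 2) ^ 2 by ring, hsq, div_pow,
        div_mul_eq_mul_div, div_le_div_iff₀ (by positivity) (by positivity)]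
      have h2 := mul_le_mul_of_nonneg_right (hpp j) (sq_nonneg ν)
      have h3 : 0 ≤ (|η j| * p j) ^ 2 * ν ^ 2 := by positivity
      nlinarith
    refine (Finset.sum_le_sum fun j _ => h1 j).trans (le_of_eq ?_)
    rw [← Finset.sum_div, ← hν2, div_self (by positivity)]

theorem oracleLambda_le_minimaxRisk {τ σ κ : ℝ} (hα : 0 < α) (hτ : tailScale α ≤ τ) (hσ : 0 < σ)
    (hκ : IsHeightFactor α κ) (hd : 0 < d) (hη : ∀ j, η j ≠ 0) (hs : 1 ≤ s)
    (hl : oracleLambda α s η ≠ 0) :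
    ENNReal.ofReal (σ ^ 2 * (κ * oracleLambda α s η * (s / 16)) ^ 2 /
      (4 * (1 + Real.exp 1) ^ 2)) ≤ minimaxRisk α τ σ s η := by
  have hS := sq_div_four_le_sum_oracleWeight hα hd hη hs hl
  have hl0 := oracleLambda_nonneg α s η
  have hpe : ∀ j, oracleWeight α s η j = Real.exp (-|oracleLambda α s η / η j| ^ α) := fun j => by
    rw [oracleWeight, abs_div, abs_of_nonneg hl0]
  have hp0 : ∀ j, 0 < oracleWeight α s η j := oracleWeight_pos α s η
  set p := oracleWeight α s η
  set l := oracleLambda α s η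
  set S := ∑ j, p j with hS'
  have hs1 : (1 : ℝ) ≤ s := by exact_mod_cast hs
  have hS0 : 0 < S := by nlinarith
  have hc : (s : ℝ) / (16 * S) ≤ 1 / 4 := by
    rw [div_le_iff₀ (by positivity)]; nlinarith
  have hc0 : 0 ≤ (s : ℝ) / (16 * S) := by positivity
  have hsum : ∑ j, s / (16 * S) * p j = s / 16 := by
    rw [← Finset.mul_sum, ← hS']; field_simp
  -- The total mass is s/16. One factor p_j absorbs the heights through `add_le`, leaving the cost
  -- at most (s/(16 S))² S = s²/(256 S), bounded because S ≥ s²/4.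
  have key := le_minimaxRisk_of_isHeightFactor (C := 1) (η := η)
    (q := fun j => s / (16 * S) * p j) hα hτ hσ hs hκ hl0 hη
    (fun j => mul_nonneg hc0 (hp0 j).le) (fun j => ?_) ?_ ?_
  · rwa [hsum] at key
  · rw [← hpe]; nlinarith [hp0 j]
  · rw [hsum]; linarith
  · have h1 : ∀ j, (s / (16 * S) * p j) ^ 2 * ((κ * |l / η j|) ^ 2 + (κ * |l / η j|) ^ 4) ≤
        (s / (16 * S)) ^ 2 * p j := fun j => by
      have h2 := hκ.add_le _ (abs_nonneg (l / η j))
      rw [← hpe] at h2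
      calc _ = (s / (16 * S)) ^ 2 * p j *
            (((κ * |l / η j|) ^ 2 + (κ * |l / η j|) ^ 4) * p j) := by ring
        _ ≤ (s / (16 * S)) ^ 2 * p j * 1 :=
            mul_le_mul_of_nonneg_left (h2.trans (by norm_num))
              (mul_nonneg (sq_nonneg _) (hp0 j).le)
        _ = _ := mul_one _
    refine (Finset.sum_le_sum fun j _ => h1 j).trans ?_
    rw [← Finset.mul_sum, ← hS', div_pow, div_mul_eq_mul_div, div_le_iff₀ (by positivity)]
    nlinarith [mul_le_mul_of_nonneg_right hS hS0.le]

theorem oracleRate_le_minimaxRisk {τ σ κ : ℝ} (hα : 0 < α) (hτ : tailScale α ≤ τ) (hσ : 0 < σ)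
    (hκ : IsHeightFactor α κ) (hd : 0 < d) (hη : ∀ j, η j ≠ 0) (hs : 1 ≤ s) :
    ENNReal.ofReal ((κ / 32) ^ 2 / (4 * (1 + Real.exp 1) ^ 2) * σ ^ 2 * oracleRate α s η) ≤
      minimaxRisk α τ σ s η := by
  have hν := oracleNu_pos (α := α) (s := s) hd hη
  have hl0 := oracleLambda_nonneg α s η
  have hls : 0 ≤ oracleLambda α s η * s := by positivity
  have hκ0 := hκ.pos
  have hκ1 := hκ.le_one
  have e : ∀ x : ℝ, (κ / 32) ^ 2 / (4 * (1 + Real.exp 1) ^ 2) * σ ^ 2 * x ^ 2 =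
      σ ^ 2 * (κ / 32 * x) ^ 2 / (4 * (1 + Real.exp 1) ^ 2) := fun x => by ring
  rw [oracleRate, e]
  -- The larger of the two terms is at least half the sum, whence κ/32 from the factors 1/16.
  rcases le_or_gt (oracleLambda α s η * s) (oracleNu α s η) with h | h
  · refine le_trans (ENNReal.ofReal_le_ofReal ?_) (oracleNu_le_minimaxRisk hα hτ hσ hd hη hs)
    gcongr
    nlinarith
  · refine le_trans (ENNReal.ofReal_le_ofReal ?_) (oracleLambda_le_minimaxRisk hα hτ hσ hκ hd hη hs
      fun h0 => ?_)
    · have hx : κ / 32 * (oracleLambda α s η * s + oracleNu α s η) ≤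
          κ * oracleLambda α s η * (s / 16) := by nlinarith
      gcongr
    · rw [h0, zero_mul] at h; linarith

end Oracle

/-! ### The asymmetric rate -/

theorem asymLambda_spec {α : ℝ} (hα : 0 < α) {d s : ℕ} {η : Fin d → ℝ} (hη : ∀ j, η j ≠ 0)
    (hs : 1 ≤ s) (hsd : s ^ 2 + s ≤ d + 1) : 0 ≤ asymLambda α s η ∧
      ∑ j ∈ tailIndices d s, Real.exp (-|asymLambda α s η / η j| ^ α) = s :=
  Classical.epsilon_spec (existsUnique_asymLambda hα hη hs hsd).exists

theorem sum_ite_lt_const {d n : ℕ} (h : n ≤ d) (c : ℝ) :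
    ∑ j : Fin d, (if (j : ℕ) < n then c else 0) = n * c := by
  rw [← Finset.sum_filter, Finset.sum_const, Fin.card_filter_val_lt, min_eq_right h, nsmul_eq_mul]

section Asymmetric

variable {α τ σ κ Cbar : ℝ} {d s : ℕ} {η : Fin d → ℝ}

/-- The asymmetric bound when the tail spikes are high: spikes on the tail. -/
theorem asymLambda_le_minimaxRisk_of_one_le (hα : 0 < α) (hτ : tailScale α ≤ τ) (hσ : 0 < σ)
    (hκ : IsHeightFactor α κ) (hη : ∀ j, η j ≠ 0) (hs : 1 ≤ s) (hsd : s ^ 2 + s ≤ d + 1)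
    (hC : asymMoment α s η ≤ Cbar)
    (hu : ∀ j ∈ tailIndices d s, 1 ≤ |asymLambda α s η / η j|) :
    ENNReal.ofReal (σ ^ 2 * (κ * asymLambda α s η * (s / 4)) ^ 2 /
      (4 * (1 + Real.exp Cbar) ^ 2)) ≤ minimaxRisk α τ σ s η := by
  obtain ⟨hl0, hl⟩ := asymLambda_spec hα hη hs hsd
  have hM : asymMoment α s η = ∑ j ∈ tailIndices d s, |asymLambda α s η / η j| ^ 4 *
      Real.exp (-|asymLambda α s η / η j| ^ α) ^ 2 := by
    refine Finset.sum_congr rfl fun j _ => ?_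
    rw [← Real.exp_nat_mul, Even.pow_abs (by decide), div_pow]
    congr 2
    push_cast; ring
  rw [hM] at hC
  set l := asymLambda α s η
  have hs0 : (0 : ℝ) ≤ s := Nat.cast_nonneg s
  have hsum : ∑ j, (if j ∈ tailIndices d s then Real.exp (-|l / η j| ^ α) / 4 else 0) = s / 4 := by
    rw [Finset.sum_ite_mem, Finset.univ_inter, ← Finset.sum_div, hl]
  have key := le_minimaxRisk_of_isHeightFactor (C := Cbar) (η := η)
    (q := fun j => if j ∈ tailIndices d s then Real.exp (-|l / η j| ^ α) / 4 else 0)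
    hα hτ hσ hs hκ hl0 hη (fun j => ?_) (fun j => ?_) ?_ ?_
  · rwa [hsum] at key
  · split_ifs <;> positivity
  · split_ifs
    · exact le_rfl
    · positivity
  · rw [hsum]; linarith
  · refine le_trans ?_ hC
    rw [← Finset.sum_subset (Finset.subset_univ (tailIndices d s)) fun j _ hj => by simp [hj]]
    refine Finset.sum_le_sum fun j hj => ?_
    rw [if_pos hj]
    have h1 := hu j hj
    set u := |l / η j|
    have hx : κ * u ≤ u := mul_le_of_le_one_left (by linarith) hκ.le_one
    have hx0 : 0 ≤ κ * u := mul_nonneg hκ.pos.le (by linarith)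
    -- This is where u ≥ 1 is needed: the moment hypothesis controls fourth powers only.
    have h2 : (κ * u) ^ 2 ≤ u ^ 4 := (pow_le_pow_left₀ hx0 hx 2).trans
      (pow_le_pow_right₀ h1 (by norm_num))
    have h4 : (κ * u) ^ 4 ≤ u ^ 4 := pow_le_pow_left₀ hx0 hx 4
    have h5 : 0 ≤ u ^ 4 * Real.exp (-u ^ α) ^ 2 := by positivity
    nlinarith [mul_le_mul_of_nonneg_right (add_le_add h2 h4) (sq_nonneg (Real.exp (-u ^ α)))]

/-- The asymmetric bound when the leading spikes are low: spikes on the leading coordinates. -/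
theorem asymLambda_le_minimaxRisk_of_le_one (hα : 0 < α) (hτ : tailScale α ≤ τ) (hσ : 0 < σ)
    (hκ : IsHeightFactor α κ) (hη : ∀ j, η j ≠ 0) (hs : 1 ≤ s) (hsd : s ^ 2 + s ≤ d + 1)
    (hu : ∀ j : Fin d, (j : ℕ) < s ^ 2 → |asymLambda α s η / η j| ≤ 1) :
    ENNReal.ofReal (σ ^ 2 * (κ * asymLambda α s η * (Real.exp (-1) * s / 4)) ^ 2 /
      (4 * (1 + Real.exp 1) ^ 2)) ≤ minimaxRisk α τ σ s η := by
  obtain ⟨hl0, -⟩ := asymLambda_spec hα hη hs hsd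
  set l := asymLambda α s η
  have hs1 : (1 : ℝ) ≤ s := by exact_mod_cast hs
  have hn : s ^ 2 ≤ d := by omega
  have he0 := Real.exp_pos (-1)
  have he1 : Real.exp (-1) ≤ 1 := Real.exp_le_one_iff.mpr (by norm_num)
  -- On s² coordinates, probability of order 1/s gives mass of order s and bounded sum of squares.
  set c := Real.exp (-1) / (4 * s) with hc
  have hc0 : 0 ≤ c := by positivity
  have hcs : s * c = Real.exp (-1) / 4 := by rw [hc]; field_simp
  have hsum : ∑ j : Fin d, (if (j : ℕ) < s ^ 2 then c else 0) = Real.exp (-1) * s / 4 := by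
    rw [sum_ite_lt_const hn]; push_cast
    rw [sq, mul_assoc, hcs]; ring
  have key := le_minimaxRisk_of_isHeightFactor (C := 1) (η := η)
    (q := fun j : Fin d => if (j : ℕ) < s ^ 2 then c else 0)
    hα hτ hσ hs hκ hl0 hη (fun j => ?_) (fun j => ?_) ?_ ?_
  · rwa [hsum] at key
  · split_ifs
    · exact hc0
    · exact le_rfl
  · split_ifs with hj
    · have h1 : |l / η j| ^ α ≤ 1 := Real.rpow_le_one (abs_nonneg _) (hu j hj) hα.le
      have h2 := Real.exp_le_exp.mpr (neg_le_neg h1)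
      nlinarith
    · positivity
  · rw [hsum]; nlinarith
  · have h1 : ∀ j : Fin d, (if (j : ℕ) < s ^ 2 then c else 0) ^ 2 *
        ((κ * |l / η j|) ^ 2 + (κ * |l / η j|) ^ 4) ≤
        if (j : ℕ) < s ^ 2 then c ^ 2 * 2 else 0 := fun j => by
      split_ifs with hj
      · have hx0 : 0 ≤ κ * |l / η j| := mul_nonneg hκ.pos.le (abs_nonneg _)
        have hx : κ * |l / η j| ≤ 1 := mul_le_one₀ hκ.le_one (abs_nonneg _) (hu j hj)
        refine mul_le_mul_of_nonneg_left ?_ (sq_nonneg c)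
        linarith [pow_le_one₀ (n := 2) hx0 hx, pow_le_one₀ (n := 4) hx0 hx]
      · simp
    refine (Finset.sum_le_sum fun j _ => h1 j).trans ?_
    rw [sum_ite_lt_const hn]; push_cast
    rw [← mul_assoc, ← mul_pow, hcs]
    nlinarith

theorem asymRate_le_minimaxRisk (hα : 0 < α) (hτ : tailScale α ≤ τ) (hσ : 0 < σ)
    (hκ : IsHeightFactor α κ) (hη : ∀ j, η j ≠ 0) (hanti : Antitone fun j => |η j|) (hs : 1 ≤ s)
    (hsd : s ^ 2 + s ≤ d + 1) (hC : asymMoment α s η ≤ Cbar) :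
    ENNReal.ofReal ((κ * Real.exp (-1) / 4) ^ 2 / (4 * (1 + Real.exp (max Cbar 1)) ^ 2) * σ ^ 2 *
      (s : ℝ) ^ 2 * asymLambda α s η ^ 2) ≤ minimaxRisk α τ σ s η := by
  have hl0 := (asymLambda_spec hα hη hs hsd).1
  have hκ0 := hκ.pos
  have hs0 : 0 < s ^ 2 := pow_pos hs 2
  have e : (κ * Real.exp (-1) / 4) ^ 2 / (4 * (1 + Real.exp (max Cbar 1)) ^ 2) * σ ^ 2 *
      (s : ℝ) ^ 2 * asymLambda α s η ^ 2 = σ ^ 2 * (κ * asymLambda α s η *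
        (Real.exp (-1) * s / 4)) ^ 2 / (4 * (1 + Real.exp (max Cbar 1)) ^ 2) := by ring
  rw [e]
  have he1 : Real.exp (-1) ≤ 1 := Real.exp_le_one_iff.mpr (by norm_num)
  have hmono : ∀ {i j : Fin d}, i ≤ j →
      |asymLambda α s η / η i| ≤ |asymLambda α s η / η j| := fun {i j} hij => by
    rw [abs_div, abs_div]
    exact div_le_div_of_nonneg_left (abs_nonneg _) (abs_pos.mpr (hη j)) (hanti hij)
  -- This is position s², the last leading coordinate and the first tail one; by monotonicity of
  -- |λ_H/η_j| its value decides between the two regimes.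
  let j₀ : Fin d := ⟨s ^ 2 - 1, by omega⟩
  rcases le_total 1 |asymLambda α s η / η j₀| with h | h
  · refine le_trans (ENNReal.ofReal_le_ofReal ?_)
      (asymLambda_le_minimaxRisk_of_one_le hα hτ hσ hκ hη hs hsd (hC.trans (le_max_left _ 1))
        fun j hj => h.trans (hmono ?_))
    · gcongr
      exact mul_le_of_le_one_left (Nat.cast_nonneg s) he1
    · simp only [tailIndices, Finset.mem_filter, Finset.mem_univ, true_and] at hj
      exact Fin.le_def.mpr (by simp only [j₀]; omega)
  · refine le_trans (ENNReal.ofReal_le_ofReal ?_)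
      (asymLambda_le_minimaxRisk_of_le_one hα hτ hσ hκ hη hs hsd
        fun j hj => (hmono ?_).trans h)
    · gcongr
      exact le_max_right _ _
    · exact Fin.le_def.mpr (by simp only [j₀]; omega)

end Asymmetric

end SparseLinear
end

theorem mainTheorem6 (α : ℝ) (hα : 0 < α) :
    ∃ τα : ℝ, 0 < τα ∧ ∃ c : ℝ, 0 < c ∧
      (∀ τ : ℝ, τα ≤ τ → ∀ (σ : ℝ) (d s : ℕ) (η : Fin d → ℝ),
        0 < σ → 1 ≤ s → s ≤ d → (∀ j, η j ≠ 0) → Antitone (fun j => |η j|) →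
        ENNReal.ofReal (c * σ ^ 2 * SparseLinear.oracleRate α s η) ≤
          SparseLinear.minimaxRisk α τ σ s η) ∧
      (∀ τ : ℝ, τα ≤ τ → ∀ Cbar : ℝ, ∃ c' : ℝ, 0 < c' ∧
        ∀ (σ : ℝ) (d s : ℕ) (η : Fin d → ℝ),
          0 < σ → 1 ≤ s → s ≤ d → (∀ j, η j ≠ 0) → Antitone (fun j => |η j|) →
          s ^ 2 + s ≤ d + 1 → SparseLinear.asymMoment α s η ≤ Cbar →
          ENNReal.ofReal (c' * σ ^ 2 * (s : ℝ) ^ 2 * SparseLinear.asymLambda α s η ^ 2) ≤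
            SparseLinear.minimaxRisk α τ σ s η) := by
  obtain ⟨κ, hκ⟩ := SparseLinear.exists_isHeightFactor hα
  have hκ0 := hκ.pos
  have h4 := SparseLinear.four_le_tailScale hα
  refine ⟨SparseLinear.tailScale α, by linarith, _, ?_,
    fun τ hτ σ d s η hσ hs hsd hη _ =>
      SparseLinear.oracleRate_le_minimaxRisk hα hτ hσ hκ (by omega) hη hs,
    fun τ hτ Cbar => ⟨_, ?_, fun σ d s η hσ hs _ hη hanti hsd hC =>
      SparseLinear.asymRate_le_minimaxRisk hα hτ hσ hκ hη hanti hs hsd hC⟩⟩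
  · positivity
  · positivity
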